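/- Let $O_{A_{\mathbb N}}$ be the (non-unital) universal $C^*$-algebra generated by a sequence of partial isometries $s_0,s_1,s_2,\dots$ subject to $$s_i^*s_j=0\ \ (i\neq j),\qquad s_i^*s_i=\sum_{k=0}^{i}s_ks_k^*\ \ (i\ge 0).$$ Let $\mathcal F$ be the weakly monotone Fock space over $\mathbb N=\{1,2,\dots\}$, i.e. the Hilbert space with orthonormal basis $e_{i_1}\otimes\cdots\otimes e_{i_k}$, $k\ge 0$, $i_1\ge\cdots\ge i_k\ge 1$ (the vector with $k=0$ is the vacuum $\Omega$). Let $P_\Omega$ be the orthogonal projection onto $\mathbb C\Omega$ and, for $i\ge 1$, let $A_i^\dagger$ be the creator: $A_i^\dagger\Omega=e_i$, $A_i^\dagger(e_{i_1}\otimes\cdots\otimes e_{i_k})=e_i\otimes e_{i_1}\otimes\cdots\otimes e_{i_k}$ if $i\ge i_1$, and $=0$ otherwise. For $z\in\mathbb T$ let $\widetilde\pi_{0,z}:O_{A_{\mathbb N}}\to B(\mathcal F)$ be the representation with $\widetilde\pi_{0,z}(s_0)=zP_\Omega$ and $\widetilde\pi_{0,z}(s_i)=A_i^\dagger$ for $i\ge1$.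 For $n\ge 0$ let $J_n$ be the closed two-sided ideal of $O_{A_{\mathbb N}}$ generated by $s_0,\dots,s_{n-1}$ (so $J_0=\{0\}$) and $p_n:O_{A_{\mathbb N}}\to O_{A_{\mathbb N}}/J_n$ the quotient map. A representation is called irreducible if it is non-zero and has no closed invariant subspace other than $\{0\}$ and the whole space. Then: 1. For every $n\ge 0$ there is a unique $*$-isomorphism $\Psi_n:O_{A_{\mathbb N}}\to O_{A_{\mathbb N}}/J_n$ with $\Psi_n(s_i)=p_n(s_{i+n})$ for all $i\ge 0$. Put $\widetilde\pi_{n,z}:=\widetilde\pi_{0,z}\circ\Psi_n^{-1}\circ p_n$ (for $n=0$ this is $\widetilde\pi_{0,z}$ itself). 2. Every $\widetilde\pi_{n,z}$ ($n\ge0$, $z\in\mathbb T$) is irreducible, and every irreducible representation of $O_{A_{\mathbb N}}$ on a Hilbert space is unitarily equivalent to $\widetilde\pi_{n,z}$ for some $n\ge 0$ and some $z\in\mathbb T$. 3. Each $\widetilde\pi_{0,z}$ is irreducible with $\widetilde\pi_{0,z}(s_0)\ne0$, and an irreducible representation $\pi$ of $O_{A_{\mathbb N}}$ satisfies $\pi(s_0)\neq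 0$ if and only if it is unitarily equivalent to $\widetilde\pi_{0,z}$ for some $z\in\mathbb T$. -/

import Mathlib

noncomputable section

open Finset

namespace WM

/-! ### The free complex `*`-algebra on generators indexed by `ℕ` -/

/-- Formal expressions in the generators. -/
inductive Pre : Type
  | of : ℕ → Pre
  | zero : Pre
  | add : Pre → Pre → Pre
  | mul : Pre → Pre → Pre
  | smul : ℂ → Pre → Pre
  | star : Pre → Pre

/-- The axioms of a (non-unital, associative) complex `*`-algebra, together with congruence. -/
inductive Rel : Pre → Pre → Prop
  | add_assoc (a b c) : Rel (.add (.add a b) c) (.add a (.add b c))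
  | add_comm (a b) : Rel (.add a b) (.add b a)
  | zero_add (a) : Rel (.add .zero a) a
  | neg_add (a) : Rel (.add (.smul (-1) a) a) .zero
  | mul_assoc (a b c) : Rel (.mul (.mul a b) c) (.mul a (.mul b c))
  | mul_add (a b c) : Rel (.mul a (.add b c)) (.add (.mul a b) (.mul a c))
  | add_mul (a b c) : Rel (.mul (.add a b) c) (.add (.mul a c) (.mul b c))
  | one_smul (a) : Rel (.smul 1 a) a
  | mul_smul (r s a) : Rel (.smul (r * s) a) (.smul r (.smul s a))
  | smul_add (r a b) : Rel (.smul r (.add a b)) (.add (.smul r a) (.smul r b))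
  | add_smul (r s a) : Rel (.smul (r + s) a) (.add (.smul r a) (.smul s a))
  | smul_mul (r a b) : Rel (.mul (.smul r a) b) (.smul r (.mul a b))
  | mul_smul' (r a b) : Rel (.mul a (.smul r b)) (.smul r (.mul a b))
  | star_star (a) : Rel (.star (.star a)) a
  | star_add (a b) : Rel (.star (.add a b)) (.add (.star a) (.star b))
  | star_mul (a b) : Rel (.star (.mul a b)) (.mul (.star b) (.star a))
  | star_smul (r : ℂ) (a) : Rel (.star (.smul r a)) (.smul (Star.star r) (.star a))
  | add_left {a b} (c) : Rel a b → Rel (.add a c) (.add b c)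
  | add_right (a) {b c} : Rel b c → Rel (.add a b) (.add a c)
  | mul_left {a b} (c) : Rel a b → Rel (.mul a c) (.mul b c)
  | mul_right (a) {b c} : Rel b c → Rel (.mul a b) (.mul a c)
  | smul_congr (r) {a b} : Rel a b → Rel (.smul r a) (.smul r b)
  | star_congr {a b} : Rel a b → Rel (.star a) (.star b)

/-- The free (non-unital) complex `*`-algebra on the generators `x_0, x_1, …`. -/
def Free : Type := Quot Rel

namespace Free

/-- The generator `x_i`. -/
def gen (i : ℕ) : Free := Quot.mk _ (.of i)

instance : Zero Free := ⟨Quot.mk _ .zero⟩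
instance : Add Free :=
  ⟨Quot.map₂ .add (fun a _ _ h => .add_right a h) (fun _ _ c h => .add_left c h)⟩
instance : Mul Free :=
  ⟨Quot.map₂ .mul (fun a _ _ h => .mul_right a h) (fun _ _ c h => .mul_left c h)⟩
instance : SMul ℂ Free := ⟨fun r => Quot.map (.smul r) (fun _ _ h => .smul_congr r h)⟩
instance : Star Free := ⟨Quot.map .star (fun _ _ h => .star_congr h)⟩
instance : Neg Free := ⟨fun a => (-1 : ℂ) • a⟩

protected theorem add_comm' (a b : Free) : a + b = b + a := by
  induction a using Quot.ind; induction b using Quot.ind; exact Quot.sound (.add_comm _ _)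

protected theorem zero_add' (a : Free) : 0 + a = a := by
  induction a using Quot.ind; exact Quot.sound (.zero_add _)

instance : AddCommGroup Free where
  add_assoc a b c := by
    induction a using Quot.ind; induction b using Quot.ind; induction c using Quot.ind
    exact Quot.sound (.add_assoc _ _ _)
  zero_add := Free.zero_add'
  add_zero a := by rw [Free.add_comm', Free.zero_add']
  add_comm := Free.add_comm'
  neg_add_cancel a := by induction a using Quot.ind; exact Quot.sound (.neg_add _)
  nsmul := nsmulRec
  zsmul := zsmulRec

instance : Module ℂ Free := Module.ofMinimalAxioms
  (fun r a b => by
    induction a using Quot.ind; induction b using Quot.ind; exact Quot.sound (.smul_add _ _ _))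
  (fun r s a => by induction a using Quot.ind; exact Quot.sound (.add_smul _ _ _))
  (fun r s a => by induction a using Quot.ind; exact Quot.sound (.mul_smul _ _ _))
  (fun a => by induction a using Quot.ind; exact Quot.sound (.one_smul _))

protected theorem mul_add' (a b c : Free) : a * (b + c) = a * b + a * c := by
  induction a using Quot.ind; induction b using Quot.ind; induction c using Quot.ind
  exact Quot.sound (.mul_add _ _ _)

protected theorem add_mul' (a b c : Free) : (a + b) * c = a * c + b * c := by
  induction a using Quot.ind; induction b using Quot.ind; induction c using Quot.ind
  exact Quot.sound (.add_mul _ _ _)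

instance : NonUnitalRing Free where
  left_distrib := Free.mul_add'
  right_distrib := Free.add_mul'
  zero_mul a := by
    have h := Free.add_mul' 0 0 a
    rw [zero_add] at h
    simpa using h
  mul_zero a := by
    have h := Free.mul_add' a 0 0
    rw [zero_add] at h
    simpa using h
  mul_assoc a b c := by
    induction a using Quot.ind; induction b using Quot.ind; induction c using Quot.ind
    exact Quot.sound (.mul_assoc _ _ _)

instance : StarRing Free where
  star_involutive a := by induction a using Quot.ind; exact Quot.sound (.star_star _)
  star_mul a b := by
    induction a using Quot.ind; induction b using Quot.ind; exact Quot.sound (.star_mul _ _)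
  star_add a b := by
    induction a using Quot.ind; induction b using Quot.ind; exact Quot.sound (.star_add _ _)

instance : StarModule ℂ Free where
  star_smul r a := by induction a using Quot.ind; exact Quot.sound (.star_smul _ _)

instance : IsScalarTower ℂ Free Free where
  smul_assoc r a b := by
    induction a using Quot.ind; induction b using Quot.ind; exact Quot.sound (.smul_mul _ _ _)

instance : SMulCommClass ℂ Free Free where
  smul_comm r a b := by
    induction a using Quot.ind; induction b using Quot.ind
    exact (Quot.sound (.mul_smul' _ _ _)).symm

/-- Induction over the free `*`-algebra. -/
theorem induction {P : Free → Prop} (hgen : ∀ i, P (gen i)) (h0 : P 0)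
    (hadd : ∀ a b, P a → P b → P (a + b)) (hmul : ∀ a b, P a → P b → P (a * b))
    (hsmul : ∀ (r : ℂ) a, P a → P (r • a)) (hstar : ∀ a, P a → P (star a)) (a : Free) : P a := by
  induction a using Quot.ind with
  | mk a =>
    induction a with
    | of i => exact hgen i
    | zero => exact h0
    | add a b ha hb => exact hadd _ _ ha hb
    | mul a b ha hb => exact hmul _ _ ha hb
    | smul r a ha => exact hsmul r _ ha
    | star a ha => exact hstar _ ha

section Eval

variable {A : Type*} [NonUnitalRing A] [StarRing A] [Module ℂ A] [IsScalarTower ℂ A A]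
  [SMulCommClass ℂ A A] [StarModule ℂ A] (S : ℕ → A)

/-- Evaluation of a formal expression. -/
def evalPre : Pre → A
  | .of i => S i
  | .zero => 0
  | .add a b => evalPre a + evalPre b
  | .mul a b => evalPre a * evalPre b
  | .smul r a => r • evalPre a
  | .star a => Star.star (evalPre a)

theorem evalPre_congr {a b : Pre} (h : Rel a b) : evalPre S a = evalPre S b := by
  induction h with
  | add_assoc => exact add_assoc _ _ _
  | add_comm => exact add_comm _ _
  | zero_add => exact zero_add _
  | neg_add => simp [evalPre]
  | mul_assoc => exact mul_assoc _ _ _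
  | mul_add => exact mul_add _ _ _
  | add_mul => exact add_mul _ _ _
  | one_smul => exact one_smul _ _
  | mul_smul => exact mul_smul _ _ _
  | smul_add => exact smul_add _ _ _
  | add_smul => exact add_smul _ _ _
  | smul_mul => exact smul_mul_assoc _ _ _
  | mul_smul' => exact mul_smul_comm _ _ _
  | star_star => exact star_star _
  | star_add => exact star_add _ _
  | star_mul => exact star_mul _ _
  | star_smul => exact star_smul _ _
  | add_left _ _ ih => simp only [evalPre, ih]
  | add_right _ _ ih => simp only [evalPre, ih]
  | mul_left _ _ ih => simp only [evalPre, ih]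
  | mul_right _ _ ih => simp only [evalPre, ih]
  | smul_congr _ _ ih => simp only [evalPre, ih]
  | star_congr _ ih => simp only [evalPre, ih]

/-- The `*`-homomorphism from the free `*`-algebra determined by the images of the generators. -/
def eval : Free →⋆ₙₐ[ℂ] A where
  toFun := Quot.lift (evalPre S) fun _ _ h => evalPre_congr S h
  map_zero' := rfl
  map_smul' r a := by induction a using Quot.ind; rfl
  map_add' a b := by induction a using Quot.ind; induction b using Quot.ind; rfl
  map_mul' a b := by induction a using Quot.ind; induction b using Quot.ind; rfl
  map_star' a := by induction a using Quot.ind; rfl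

@[simp] theorem eval_gen (i : ℕ) : eval S (gen i) = S i := rfl

end Eval

end Free

/-! ### The universal C*-algebra -/

/-- A sequence of partial isometries `S 0, S 1, …` with `S i* S j = 0` for `i ≠ j` and
`S i* S i = ∑_{k ≤ i} S k S k*`. -/
structure IsWMFamily {A : Type*} [NonUnitalRing A] [StarRing A] (S : ℕ → A) : Prop where
  partialIsometry : ∀ i, S i * star (S i) * S i = S i
  orthogonal : ∀ i j, i ≠ j → star (S i) * S j = 0
  support : ∀ i, star (S i) * S i = ∑ k ∈ range (i + 1), S k * star (S k)

/-- The C*-seminorms on the free `*`-algebra for which the generators satisfy the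
relations `IsWMFamily`. -/
structure CSeminorm where
  toSeminorm : Seminorm ℂ Free
  mul_le : ∀ a b, toSeminorm (a * b) ≤ toSeminorm a * toSeminorm b
  star_mul_self : ∀ a, toSeminorm (star a * a) = toSeminorm a ^ 2
  partialIsometry : ∀ i, toSeminorm (.gen i * star (.gen i) * .gen i - .gen i) = 0
  orthogonal : ∀ i j, i ≠ j → toSeminorm (star (.gen i) * .gen j) = 0
  support : ∀ i,
    toSeminorm (star (.gen i) * .gen i - ∑ k ∈ range (i + 1), .gen k * star (.gen k)) = 0

namespace CSeminorm

instance : CoeFun CSeminorm fun _ => Free → ℝ := ⟨fun p => p.toSeminorm⟩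

instance : Inhabited CSeminorm :=
  ⟨{ toSeminorm := 0
     mul_le := fun _ _ => by simp
     star_mul_self := fun _ => by simp
     partialIsometry := fun _ => rfl
     orthogonal := fun _ _ _ => rfl
     support := fun _ => rfl }⟩

variable (p : CSeminorm)

theorem mul_le' (a b : Free) : p (a * b) ≤ p a * p b := p.mul_le a b

theorem star_mul_self' (a : Free) : p (star a * a) = p a ^ 2 := p.star_mul_self a

theorem le_star (a : Free) : p a ≤ p (star a) := by
  rcases (apply_nonneg p.toSeminorm a).eq_or_lt with h | h
  · rw [← h]; exact apply_nonneg p.toSeminorm _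
  · have h1 := p.mul_le' (star a) a
    rw [p.star_mul_self', sq] at h1
    exact le_of_mul_le_mul_right h1 h

theorem star_eq (a : Free) : p (star a) = p a :=
  le_antisymm (by simpa using p.le_star (star a)) (p.le_star a)

theorem gen_le (i : ℕ) : p (.gen i) ≤ 1 := by
  have hs : p (star (.gen i) * .gen i * (star (.gen i) * .gen i)) ≤ p (star (.gen i) * .gen i) := by
    have h2 : p (star (.gen i) * (.gen i * star (.gen i) * .gen i - .gen i)) = 0 := by
      refine le_antisymm ((p.mul_le' _ _).trans ?_) (apply_nonneg p.toSeminorm _)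
      have h : p (.gen i * star (.gen i) * .gen i - .gen i) = 0 := p.partialIsometry i
      rw [h, mul_zero]
    have h3 := map_add_le_add p.toSeminorm
      (star (.gen i) * (.gen i * star (.gen i) * .gen i - .gen i)) (star (.gen i) * .gen i)
    rw [mul_sub, sub_add_cancel] at h3
    rw [mul_sub] at h2
    simp only [mul_assoc] at h2 h3 ⊢
    linarith
  have hq := p.star_mul_self' (star (.gen i) * .gen i)
  rw [star_mul, star_star] at hq
  rw [hq, p.star_mul_self'] at hs
  by_contra! hlt
  have h1 : 1 < p (.gen i) ^ 2 := by nlinarith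
  nlinarith [pow_pos (zero_lt_one.trans hlt) 2, mul_pos (sub_pos.2 hlt) (zero_lt_one.trans hlt)]

theorem bddAbove (a : Free) : ∃ C : ℝ, ∀ p : CSeminorm, p a ≤ C := by
  induction a using Free.induction with
  | hgen i => exact ⟨1, fun p => p.gen_le i⟩
  | h0 => exact ⟨0, fun p => (map_zero p.toSeminorm).le⟩
  | hadd a b ha hb =>
    obtain ⟨C, hC⟩ := ha
    obtain ⟨D, hD⟩ := hb
    exact ⟨C + D, fun p => (map_add_le_add p.toSeminorm a b).trans (add_le_add (hC p) (hD p))⟩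
  | hmul a b ha hb =>
    obtain ⟨C, hC⟩ := ha
    obtain ⟨D, hD⟩ := hb
    refine ⟨C * D, fun p => (p.mul_le' a b).trans ?_⟩
    exact mul_le_mul (hC p) (hD p) (apply_nonneg p.toSeminorm _)
      ((apply_nonneg p.toSeminorm _).trans (hC p))
  | hsmul r a ha =>
    obtain ⟨C, hC⟩ := ha
    refine ⟨‖r‖ * C, fun p => ?_⟩
    rw [map_smul_eq_mul]
    exact mul_le_mul_of_nonneg_left (hC p) (norm_nonneg _)
  | hstar a ha =>
    obtain ⟨C, hC⟩ := ha
    exact ⟨C, fun p => by rw [p.star_eq]; exact hC p⟩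

end CSeminorm

/-- The maximal C*-seminorm compatible with the relations. -/
def maxNorm (a : Free) : ℝ := ⨆ p : CSeminorm, p a

theorem le_maxNorm (p : CSeminorm) (a : Free) : p a ≤ maxNorm a := by
  obtain ⟨C, hC⟩ := CSeminorm.bddAbove a
  exact le_ciSup (f := fun p : CSeminorm => p a) ⟨C, by rintro _ ⟨q, rfl⟩; exact hC q⟩ p

theorem maxNorm_le {a : Free} {C : ℝ} (h : ∀ p : CSeminorm, p a ≤ C) : maxNorm a ≤ C :=
  ciSup_le h

theorem maxNorm_nonneg (a : Free) : 0 ≤ maxNorm a :=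
  (apply_nonneg (default : CSeminorm).toSeminorm a).trans (le_maxNorm default a)

/-- `maxNorm` as a seminorm. -/
def maxSeminorm : Seminorm ℂ Free := Seminorm.of maxNorm
  (fun a b => maxNorm_le fun p => (map_add_le_add p.toSeminorm a b).trans
    (add_le_add (le_maxNorm p a) (le_maxNorm p b)))
  (fun r a => by
    refine le_antisymm (maxNorm_le fun p => ?_) ?_
    · rw [map_smul_eq_mul]
      exact mul_le_mul_of_nonneg_left (le_maxNorm p a) (norm_nonneg _)
    · unfold maxNorm
      rw [Real.mul_iSup_of_nonneg (norm_nonneg _)]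
      refine ciSup_le fun p => ?_
      rw [← map_smul_eq_mul p.toSeminorm]
      exact le_maxNorm p _)

instance : SeminormedAddCommGroup Free := maxSeminorm.toAddGroupSeminorm.toSeminormedAddCommGroup

theorem norm_def (a : Free) : ‖a‖ = maxNorm a := rfl

instance : NormedSpace ℂ Free where
  norm_smul_le r a := (map_smul_eq_mul maxSeminorm r a).le

theorem norm_mul_le' (a b : Free) : ‖a * b‖ ≤ ‖a‖ * ‖b‖ :=
  maxNorm_le fun p => (p.mul_le' a b).trans
    (mul_le_mul (le_maxNorm p a) (le_maxNorm p b) (apply_nonneg p.toSeminorm _) (maxNorm_nonneg a))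

instance : NonUnitalSeminormedRing Free where
  dist_eq := dist_eq_norm_neg_add
  norm_mul_le := norm_mul_le'

theorem norm_star' (a : Free) : ‖star a‖ = ‖a‖ :=
  iSup_congr fun p => p.star_eq a

theorem norm_mul_self_le' (a : Free) : ‖a‖ * ‖a‖ ≤ ‖star a * a‖ := by
  have h : ‖a‖ ≤ √‖star a * a‖ := maxNorm_le fun p => Real.le_sqrt_of_sq_le (by
    rw [← p.star_mul_self']; exact le_maxNorm p _)
  calc ‖a‖ * ‖a‖ ≤ √‖star a * a‖ * √‖star a * a‖ :=
        mul_self_le_mul_self (norm_nonneg _) h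
    _ = _ := Real.mul_self_sqrt (norm_nonneg _)

open UniformSpace in
/-- The universal C*-algebra `O_{A_ℕ}`: the (Hausdorff) completion of the free `*`-algebra in the
maximal C*-seminorm compatible with the relations. -/
def OA : Type := Completion Free

namespace OA

open UniformSpace Completion

instance : NormedAddCommGroup OA := inferInstanceAs (NormedAddCommGroup (Completion Free))
instance : NormedSpace ℂ OA := inferInstanceAs (NormedSpace ℂ (Completion Free))
instance : CompleteSpace OA := inferInstanceAs (CompleteSpace (Completion Free))

/-- The canonical map from the free `*`-algebra. -/
def coe (a : Free) : OA := ((a : Completion Free) :)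

theorem denseRange_coe : DenseRange coe := Completion.denseRange_coe
theorem continuous_coe : Continuous coe := Completion.continuous_coe Free
theorem isDenseInducing_coe : IsDenseInducing coe := Completion.isDenseInducing_coe
theorem norm_coe (a : Free) : ‖coe a‖ = ‖a‖ := Completion.norm_coe a
theorem coe_zero : coe 0 = 0 := rfl
theorem coe_add (a b : Free) : coe (a + b) = coe a + coe b := Completion.coe_add a b
theorem coe_smul (r : ℂ) (a : Free) : coe (r • a) = r • coe a := Completion.coe_smul r a

@[elab_as_elim]
theorem ind {p : OA → Prop} (x : OA) (hp : IsClosed {x | p x}) (h : ∀ a, p (coe a)) : p x :=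
  Completion.induction_on x hp h

@[elab_as_elim]
theorem ind₂ {p : OA → OA → Prop} (x y : OA) (hp : IsClosed {x : OA × OA | p x.1 x.2})
    (h : ∀ a b, p (coe a) (coe b)) : p x y :=
  Completion.induction_on₂ x y hp h

@[elab_as_elim]
theorem ind₃ {p : OA → OA → OA → Prop} (x y z : OA)
    (hp : IsClosed {x : OA × OA × OA | p x.1 x.2.1 x.2.2})
    (h : ∀ a b c, p (coe a) (coe b) (coe c)) : p x y z :=
  Completion.induction_on₃ x y z hp h

instance : Mul OA :=
  ⟨fun x y => (isDenseInducing_coe.prodMap isDenseInducing_coe).extend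
    (fun q : Free × Free => coe (q.1 * q.2)) (x, y)⟩

theorem coe_mul (a b : Free) : coe (a * b) = coe a * coe b :=
  ((isDenseInducing_coe.prodMap isDenseInducing_coe).extend_eq
    (f := fun q : Free × Free => coe (q.1 * q.2))
    (continuous_coe.comp continuous_mul) (a, b)).symm

instance : ContinuousMul OA where
  continuous_mul := by
    let c : Free →+ OA := ⟨⟨coe, coe_zero⟩, coe_add⟩
    let m := (AddMonoidHom.mul : Free →+ Free →+ Free).compr₂ c
    have hm : Continuous fun p : Free × Free => m p.1 p.2 := continuous_coe.comp continuous_mul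
    have di : IsDenseInducing (c : Free → OA) := isDenseInducing_coe
    exact (di.extend_Z_bilin di hm :)

instance : Star OA := ⟨Completion.map (star : Free → Free)⟩

theorem uniformContinuous_star : UniformContinuous (star : Free → Free) := by
  refine Metric.uniformContinuous_iff.2 fun ε hε => ⟨ε, hε, fun {a b} h => ?_⟩
  rwa [dist_eq_norm, ← star_sub, norm_star', ← dist_eq_norm]

theorem coe_star (a : Free) : coe (star a) = star (coe a) :=
  (Completion.map_coe uniformContinuous_star a).symm

instance : ContinuousStar OA := ⟨Completion.continuous_map⟩

instance : NonUnitalNormedRing OA where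
  __ := (inferInstance : NormedAddCommGroup OA)
  left_distrib x y z := by
    refine ind₃ x y z (isClosed_eq (by fun_prop) (by fun_prop)) fun a b c => ?_
    rw [← coe_add, ← coe_mul, ← coe_mul, ← coe_mul, ← coe_add, mul_add]
  right_distrib x y z := by
    refine ind₃ x y z (isClosed_eq (by fun_prop) (by fun_prop)) fun a b c => ?_
    rw [← coe_add, ← coe_mul, ← coe_mul, ← coe_mul, ← coe_add, add_mul]
  zero_mul x := by
    refine ind x (isClosed_eq (by fun_prop) (by fun_prop)) fun a => ?_
    rw [← coe_zero, ← coe_mul, zero_mul]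
  mul_zero x := by
    refine ind x (isClosed_eq (by fun_prop) (by fun_prop)) fun a => ?_
    rw [← coe_zero, ← coe_mul, mul_zero]
  mul_assoc x y z := by
    refine ind₃ x y z (isClosed_eq (by fun_prop) (by fun_prop)) fun a b c => ?_
    rw [← coe_mul, ← coe_mul, ← coe_mul, ← coe_mul, mul_assoc]
  norm_mul_le x y := by
    refine ind₂ x y (isClosed_le (by fun_prop) (by fun_prop)) fun a b => ?_
    rw [← coe_mul, norm_coe, norm_coe, norm_coe]
    exact norm_mul_le' a b

instance : StarRing OA where
  star_involutive x := by
    refine ind x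
      (isClosed_eq (by fun_prop) (by fun_prop)) fun a => ?_
    rw [← coe_star, ← coe_star, star_star]
  star_mul x y := by
    refine ind₂ x y (isClosed_eq (by fun_prop) (by fun_prop)) fun a b => ?_
    rw [← coe_mul, ← coe_star, ← coe_star, ← coe_star, ← coe_mul, star_mul]
  star_add x y := by
    refine ind₂ x y (isClosed_eq (by fun_prop) (by fun_prop)) fun a b => ?_
    rw [← coe_add, ← coe_star, ← coe_star, ← coe_star, ← coe_add, star_add]

theorem continuous_smul' (r : ℂ) : Continuous fun x : OA => r • x :=
  (lipschitzWith_smul r).continuous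

theorem coe_smul_mul (r : ℂ) (a b : Free) : r • coe a * coe b = r • (coe a * coe b) := by
  rw [← coe_smul, ← coe_mul, ← coe_mul, ← coe_smul, smul_mul_assoc]

theorem coe_mul_smul (r : ℂ) (a b : Free) : r • (coe a * coe b) = coe a * r • coe b := by
  rw [← coe_smul, ← coe_mul, ← coe_mul, ← coe_smul, mul_smul_comm]

instance : NonUnitalCStarAlgebra OA where
  norm_mul_self_le x := by
    refine ind x (isClosed_le (by fun_prop) (by fun_prop)) fun a => ?_
    rw [← coe_star, ← coe_mul, norm_coe, norm_coe]
    exact norm_mul_self_le' a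
  smul_assoc r x y := ind₂ x y
    (isClosed_eq (((continuous_smul' r).comp continuous_fst).mul continuous_snd)
      ((continuous_smul' r).comp (continuous_fst.mul continuous_snd)))
    (coe_smul_mul r)
  smul_comm r x y := ind₂ x y
    (isClosed_eq ((continuous_smul' r).comp (continuous_fst.mul continuous_snd))
      (continuous_fst.mul ((continuous_smul' r).comp continuous_snd)))
    (coe_mul_smul r)
  star_smul r x := by
    refine ind x (isClosed_eq (continuous_star.comp (continuous_smul' r))
      ((continuous_smul' _).comp continuous_star)) fun a => ?_
    rw [← coe_smul, ← coe_star, ← coe_star, ← coe_smul, star_smul]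

/-- The canonical generators `s_0, s_1, …`. -/
def s (i : ℕ) : OA := coe (.gen i)

/-- `coe` as a `*`-homomorphism. -/
def coeHom : Free →⋆ₙₐ[ℂ] OA where
  toFun := coe
  map_zero' := coe_zero
  map_smul' := coe_smul
  map_add' := coe_add
  map_mul' := coe_mul
  map_star' := coe_star

theorem coe_eq_zero {a : Free} (h : ∀ p : CSeminorm, p a = 0) : coe a = 0 := by
  rw [← norm_eq_zero, norm_coe, norm_def]
  exact le_antisymm (maxNorm_le fun p => (h p).le) (maxNorm_nonneg a)

theorem isWMFamily_s : IsWMFamily s where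
  partialIsometry i := by
    have h : coeHom _ = 0 := coe_eq_zero fun p => p.partialIsometry i
    rw [map_sub, map_mul, map_mul, map_star, sub_eq_zero] at h
    exact h
  orthogonal i j hij := by
    have h : coeHom _ = 0 := coe_eq_zero fun p => p.orthogonal i j hij
    rw [map_mul, map_star] at h
    exact h
  support i := by
    have h : coeHom _ = 0 := coe_eq_zero fun p => p.support i
    rw [map_sub, map_sum, map_mul, map_star, sub_eq_zero] at h
    simp only [map_mul, map_star] at h
    exact h

section Lift

variable {A : Type*} [NonUnitalCStarAlgebra A] {S : ℕ → A}

theorem eval_seminorm (a : Free) :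
    (normSeminorm ℂ A).comp (Free.eval S : Free →ₗ[ℂ] A) a = ‖Free.eval S a‖ := rfl

/-- The C*-seminorm obtained from a family in a C*-algebra satisfying the relations. -/
def pullback (hS : IsWMFamily S) : CSeminorm where
  toSeminorm := (normSeminorm ℂ A).comp (Free.eval S : Free →ₗ[ℂ] A)
  mul_le a b := by
    change ‖Free.eval S (a * b)‖ ≤ ‖Free.eval S a‖ * ‖Free.eval S b‖
    rw [map_mul]; exact norm_mul_le _ _
  star_mul_self a := by
    change ‖Free.eval S (star a * a)‖ = ‖Free.eval S a‖ ^ 2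
    rw [map_mul, map_star, CStarRing.norm_star_mul_self, sq]
  partialIsometry i := by
    rw [eval_seminorm, norm_eq_zero, map_sub, sub_eq_zero]
    simpa only [map_mul, map_star, Free.eval_gen] using hS.partialIsometry i
  orthogonal i j hij := by
    rw [eval_seminorm, norm_eq_zero]
    simpa only [map_mul, map_star, Free.eval_gen] using hS.orthogonal i j hij
  support i := by
    rw [eval_seminorm, norm_eq_zero, map_sub, sub_eq_zero]
    simpa only [map_sum, map_mul, map_star, Free.eval_gen] using hS.support i

theorem uniformContinuous_eval (hS : IsWMFamily S) : UniformContinuous (Free.eval S) := by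
  refine Metric.uniformContinuous_iff.2 fun ε hε => ⟨ε, hε, fun {a b} h => ?_⟩
  rw [dist_eq_norm] at h ⊢
  rw [← map_sub]
  exact (le_maxNorm (pullback hS) (a - b)).trans_lt h

/-- The underlying function of `lift`. -/
def liftFun (_hS : IsWMFamily S) : OA → A := Completion.extension (Free.eval S)

theorem liftFun_coe (hS : IsWMFamily S) (a : Free) : liftFun hS (coe a) = Free.eval S a :=
  Completion.extension_coe (uniformContinuous_eval hS) a

theorem continuous_liftFun (hS : IsWMFamily S) : Continuous (liftFun hS) := Completion.continuous_extension

/-- The universal property: a family in a C*-algebra which satisfies the relations extends to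
a `*`-homomorphism. -/
def lift (hS : IsWMFamily S) : OA →⋆ₙₐ[ℂ] A where
  toFun := liftFun hS
  map_zero' := by rw [← coe_zero, liftFun_coe, map_zero]
  map_smul' r x := by
    refine ind x (isClosed_eq ((continuous_liftFun hS).comp (continuous_smul' r))
      ((continuous_liftFun hS).const_smul r)) fun a => ?_
    rw [← coe_smul, liftFun_coe, liftFun_coe, map_smul]; rfl
  map_add' x y := by
    have := continuous_liftFun hS
    refine ind₂ x y (isClosed_eq (by fun_prop) (by fun_prop)) fun a b => ?_
    rw [← coe_add, liftFun_coe, liftFun_coe, liftFun_coe, map_add]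
  map_mul' x y := by
    have := continuous_liftFun hS
    refine ind₂ x y (isClosed_eq (by fun_prop) (by fun_prop)) fun a b => ?_
    rw [← coe_mul, liftFun_coe, liftFun_coe, liftFun_coe, map_mul]
  map_star' x := by
    have := continuous_liftFun hS
    refine ind x (isClosed_eq (by fun_prop) (by fun_prop)) fun a => ?_
    rw [← coe_star, liftFun_coe, liftFun_coe, map_star]

theorem lift_s (hS : IsWMFamily S) (i : ℕ) : lift hS (s i) = S i := liftFun_coe hS (.gen i)

end Lift

end OA

/-! ### Ideals and quotients -/

/-- The closed two-sided ideal of a C*-algebra generated by a set. -/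
def closedIdeal {A : Type*} [NonUnitalCStarAlgebra A] (T : Set A) : Submodule ℂ A :=
  sInf {J | IsClosed (J : Set A) ∧ (∀ a x, x ∈ J → a * x ∈ J ∧ x * a ∈ J) ∧ T ⊆ J}

/-- `J_n`, the closed two-sided ideal generated by `s_0, …, s_{n-1}`. -/
def idealJ (n : ℕ) : Submodule ℂ OA := closedIdeal {x | ∃ i < n, x = OA.s i}

theorem closedIdeal_mul {A : Type*} [NonUnitalCStarAlgebra A] {T : Set A} (a : A) {x : A}
    (hx : x ∈ closedIdeal T) : a * x ∈ closedIdeal T ∧ x * a ∈ closedIdeal T := by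
  simp only [closedIdeal, Submodule.mem_sInf] at hx ⊢
  exact ⟨fun I hI => (hI.2.1 a x (hx I hI)).1, fun I hI => (hI.2.1 a x (hx I hI)).2⟩

theorem idealJ_mul_left {n : ℕ} (a : OA) {x : OA} (hx : x ∈ idealJ n) : a * x ∈ idealJ n :=
  (closedIdeal_mul a hx).1

theorem idealJ_mul_right {n : ℕ} (a : OA) {x : OA} (hx : x ∈ idealJ n) : x * a ∈ idealJ n :=
  (closedIdeal_mul a hx).2

theorem idealJ_star {n : ℕ} {x : OA} (hx : x ∈ idealJ n) : star x ∈ idealJ n := by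
  simp only [idealJ, closedIdeal, Submodule.mem_sInf] at hx ⊢
  rintro I ⟨hc, hm, hT⟩
  let I' : Submodule ℂ OA :=
    { carrier := {y | star y ∈ I}
      add_mem' := fun {a b} ha hb => by
        simp only [Set.mem_ofPred_eq, star_add] at *; exact I.add_mem ha hb
      zero_mem' := by simp
      smul_mem' := fun r a ha => by
        simp only [Set.mem_ofPred_eq, star_smul] at *; exact I.smul_mem _ ha }
  refine hx I' ⟨hc.preimage continuous_star, fun a y hy => ⟨?_, ?_⟩, ?_⟩
  · change star (a * y) ∈ I
    rw [star_mul]; exact (hm _ _ hy).2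
  · change star (y * a) ∈ I
    rw [star_mul]; exact (hm _ _ hy).1
  · rintro _ ⟨i, hi, rfl⟩
    change star (OA.s i) ∈ I
    rw [← OA.isWMFamily_s.partialIsometry i, star_mul, star_mul, star_star]
    rw [← mul_assoc]
    exact (hm _ _ (hm _ _ (hT ⟨i, hi, rfl⟩)).1).2

/-- The quotient `O_{A_ℕ} / J_n`. -/
abbrev Q (n : ℕ) : Type := OA ⧸ idealJ n

namespace Q

variable {n : ℕ}

instance : Mul (Q n) :=
  ⟨Quotient.map₂ (· * ·) fun a b hab c d hcd => by
    have hab' : a - b ∈ idealJ n := (Submodule.quotientRel_def _).1 hab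
    have hcd' : c - d ∈ idealJ n := (Submodule.quotientRel_def _).1 hcd
    refine (Submodule.quotientRel_def _).2 ?_
    have h : a * c - b * d = (a - b) * c + b * (c - d) := by rw [sub_mul, mul_sub]; abel
    rw [h]
    exact (idealJ n).add_mem (idealJ_mul_right _ hab') (idealJ_mul_left _ hcd')⟩

instance : Star (Q n) :=
  ⟨Quotient.map star fun a b hab => by
    have hab' : a - b ∈ idealJ n := (Submodule.quotientRel_def _).1 hab
    refine (Submodule.quotientRel_def _).2 ?_
    rw [← star_sub]
    exact idealJ_star hab'⟩

theorem mk_mul (a b : OA) : (Submodule.Quotient.mk (a * b) : Q n) =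
    Submodule.Quotient.mk a * Submodule.Quotient.mk b := rfl

theorem mk_star (a : OA) : (Submodule.Quotient.mk (star a) : Q n) =
    star (Submodule.Quotient.mk a) := rfl

instance : NonUnitalRing (Q n) where
  __ := (inferInstance : AddCommGroup (Q n))
  left_distrib := by
    rintro ⟨a⟩ ⟨b⟩ ⟨c⟩; exact congrArg Submodule.Quotient.mk (mul_add a b c)
  right_distrib := by
    rintro ⟨a⟩ ⟨b⟩ ⟨c⟩; exact congrArg Submodule.Quotient.mk (add_mul a b c)
  zero_mul := by rintro ⟨a⟩; exact congrArg Submodule.Quotient.mk (zero_mul a)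
  mul_zero := by rintro ⟨a⟩; exact congrArg Submodule.Quotient.mk (mul_zero a)
  mul_assoc := by
    rintro ⟨a⟩ ⟨b⟩ ⟨c⟩; exact congrArg Submodule.Quotient.mk (mul_assoc a b c)

instance : StarRing (Q n) where
  star_involutive := by rintro ⟨a⟩; exact congrArg Submodule.Quotient.mk (star_star a)
  star_mul := by rintro ⟨a⟩ ⟨b⟩; exact congrArg Submodule.Quotient.mk (star_mul a b)
  star_add := by rintro ⟨a⟩ ⟨b⟩; exact congrArg Submodule.Quotient.mk (star_add a b)

instance : StarModule ℂ (Q n) where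
  star_smul r := by rintro ⟨a⟩; exact congrArg Submodule.Quotient.mk (star_smul r a)

instance : IsScalarTower ℂ (Q n) (Q n) where
  smul_assoc r := by
    rintro ⟨a⟩ ⟨b⟩; exact congrArg Submodule.Quotient.mk (smul_mul_assoc r a b)

instance : SMulCommClass ℂ (Q n) (Q n) where
  smul_comm r := by
    rintro ⟨a⟩ ⟨b⟩; exact congrArg Submodule.Quotient.mk (mul_smul_comm r a b).symm

end Q

/-- The canonical projection `p_n : O_{A_ℕ} → O_{A_ℕ} / J_n`. -/
def proj (n : ℕ) : OA →⋆ₙₐ[ℂ] Q n where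
  toFun := Submodule.Quotient.mk
  map_zero' := rfl
  map_smul' _ _ := rfl
  map_add' _ _ := rfl
  map_mul' := Q.mk_mul
  map_star' := Q.mk_star

/-! ### The weakly monotone Fock space over `ℕ` -/

/-- The tuples `i_1 ≥ i_2 ≥ ⋯ ≥ i_k ≥ 1`, `k ≥ 0`. -/
@[ext]
structure Tup where
  val : List ℕ
  sorted : val.Pairwise (· ≥ ·)
  pos : ∀ j ∈ val, 1 ≤ j

namespace Tup

/-- The empty tuple. -/
def nil : Tup := ⟨[], by simp, by simp⟩

/-- The first entry of a tuple (`0` for the empty tuple). -/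
def head (γ : Tup) : ℕ := γ.val.headD 0

/-- `(i_1, …, i_k) ↦ (i, i_1, …, i_k)` for `i ≥ 1`, defined if `i ≥ i_1` or `k = 0`. -/
def push (i : ℕ) (γ : Tup) : Option Tup :=
  if h : 1 ≤ i ∧ γ.head ≤ i then
    some
      { val := i :: γ.val
        sorted := by
          obtain ⟨l, hs, hp⟩ := γ
          refine List.pairwise_cons.2 ⟨fun j hj => ?_, hs⟩
          cases l with
          | nil => cases hj
          | cons a l =>
            have ha : a ≤ i := h.2
            rcases List.mem_cons.1 hj with rfl | hj
            · exact ha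
            · exact le_trans ((List.pairwise_cons.1 hs).1 j hj) ha
        pos := by
          intro j hj
          rcases List.mem_cons.1 hj with rfl | hj
          · exact h.1
          · exact γ.pos j hj }
  else none

/-- `(i, i_2, …, i_k) ↦ (i_2, …, i_k)`, defined if the first entry is `i`. -/
def pop (i : ℕ) : Tup → Option Tup
  | ⟨[], _, _⟩ => none
  | ⟨a :: l, hs, hp⟩ => if a = i then
      some ⟨l, (List.pairwise_cons.1 hs).2, fun j hj => hp j (List.mem_cons_of_mem _ hj)⟩
    else none

theorem push_isSome {i : ℕ} {γ : Tup} : (push i γ).isSome ↔ 1 ≤ i ∧ γ.head ≤ i := by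
  unfold push
  split_ifs with h <;> simp [h]

theorem push_eq_some {i : ℕ} {γ δ : Tup} : push i γ = some δ ↔ δ.val = i :: γ.val := by
  unfold push
  split_ifs with h
  · rw [Option.some.injEq]
    exact ⟨fun e => by rw [← e], fun e => Tup.ext e.symm⟩
  · refine ⟨fun e => (by cases e), fun e => (h ?_).elim⟩
    have h1 := δ.sorted
    have h2 := δ.pos
    rw [e] at h1 h2
    refine ⟨h2 i (by simp), ?_⟩
    obtain ⟨l, hs, hp⟩ := γ
    cases l with
    | nil => exact Nat.zero_le _
    | cons a l => exact (List.pairwise_cons.1 h1).1 a (by simp)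

theorem pop_eq_some {i : ℕ} {γ δ : Tup} : pop i γ = some δ ↔ γ.val = i :: δ.val := by
  obtain ⟨l, hs, hp⟩ := γ
  cases l with
  | nil => simp [pop]
  | cons a l =>
    simp only [pop]
    split_ifs with hi
    · rw [Option.some.injEq]
      subst hi
      exact ⟨fun e => by rw [← e], fun e => Tup.ext (List.cons.inj e).2⟩
    · exact ⟨fun e => (by cases e), fun e => (hi (List.cons.inj e).1).elim⟩

theorem pop_isSome {i : ℕ} {γ : Tup} (hi : 1 ≤ i) : (pop i γ).isSome ↔ γ.head = i := by
  obtain ⟨l, hs, hp⟩ := γ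
  cases l with
  | nil => simp only [pop, head, List.headD_nil, Option.isSome_none, Bool.false_eq_true, false_iff]
           omega
  | cons a l =>
    simp only [pop, head, List.headD_cons]
    split_ifs with h <;> simp [h]

theorem head_eq_zero {γ : Tup} : γ.head = 0 ↔ γ = nil := by
  obtain ⟨l, hs, hp⟩ := γ
  cases l with
  | nil => exact ⟨fun _ => rfl, fun _ => rfl⟩
  | cons a l =>
    constructor
    · intro h0
      have := hp a (by simp)
      change a = 0 at h0
      omega
    · intro h0
      have := congrArg Tup.val h0
      simp [Tup.nil] at this

/-- `push i` as a partial bijection with partial inverse `pop i`. -/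
def pushEquiv (i : ℕ) : Tup ≃. Tup where
  toFun := push i
  invFun := pop i
  inv γ δ := by
    exact pop_eq_some.trans push_eq_some.symm

end Tup

/-- The weakly monotone Fock space: the Hilbert space with orthonormal basis
`e_γ = e_{i_1} ⊗ ⋯ ⊗ e_{i_k}`, `γ = (i_1 ≥ ⋯ ≥ i_k ≥ 1)`, including the vacuum `Ω = e_∅`. -/
abbrev Fock : Type := lp (fun _ : Tup => ℂ) 2

namespace Fock

open Classical in
/-- The basis vector `e_γ`. -/
def e (γ : Tup) : Fock := lp.single 2 γ 1

/-- The vacuum vector `Ω`. -/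
def vacuum : Fock := e Tup.nil

/-- Coefficients of the image of `f` under the operator `e_γ ↦ e_{φ γ}`
(`e_γ ↦ 0` if `φ γ` is undefined). -/
def shiftFun (φ : Tup ≃. Tup) (f : Tup → ℂ) (γ : Tup) : ℂ := (φ.symm γ).elim 0 f

theorem sum_shiftFun_le (φ : Tup ≃. Tup) (f : Fock) (t : Finset Tup) :
    ∑ γ ∈ t, ‖shiftFun φ f γ‖ ^ (2 : ENNReal).toReal ≤ ‖f‖ ^ (2 : ENNReal).toReal := by
  classical
  have h0 : ∑ γ ∈ t, ‖shiftFun φ f γ‖ ^ (2 : ENNReal).toReal =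
      ∑ δ ∈ t.filterMap φ.symm (fun a a' b h h' => PEquiv.inj φ.symm h h'),
        ‖f δ‖ ^ (2 : ENNReal).toReal := by
    induction t using Finset.induction_on with
    | empty => simp
    | insert a t ha ih =>
      rw [Finset.sum_insert ha, ih]
      cases hs : φ.symm a with
      | none =>
        have : (insert a t).filterMap φ.symm (fun a a' b h h' => PEquiv.inj φ.symm h h') =
            t.filterMap φ.symm (fun a a' b h h' => PEquiv.inj φ.symm h h') := by
          ext b; simp [hs]
        rw [this]
        simp [shiftFun, hs]
      | some b =>
        have : (insert a t).filterMap φ.symm (fun a a' b h h' => PEquiv.inj φ.symm h h') =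
            insert b (t.filterMap φ.symm (fun a a' b h h' => PEquiv.inj φ.symm h h')) := by
          ext c; simp [hs, eq_comm]
        rw [this, Finset.sum_insert]
        · simp [shiftFun, hs]
        · simp only [Finset.mem_filterMap, not_exists, not_and]
          intro a' ha' h'
          exact ha (PEquiv.inj φ.symm (b := b) hs h' ▸ ha')
  rw [h0]
  exact lp.sum_rpow_le_norm_rpow (by norm_num) f _

/-- The operator `e_γ ↦ e_{φ γ}` (and `e_γ ↦ 0` if `φ γ` is undefined) of a partial bijection. -/
def shiftOp (φ : Tup ≃. Tup) : Fock →L[ℂ] Fock :=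
  LinearMap.mkContinuous
    { toFun := fun f => ⟨shiftFun φ f, memℓp_gen' (sum_shiftFun_le φ f)⟩
      map_add' := fun f g => by
        ext γ
        change shiftFun φ (f + g : Fock) γ = shiftFun φ f γ + shiftFun φ g γ
        unfold shiftFun
        cases φ.symm γ with
        | none => exact (add_zero (0 : ℂ)).symm
        | some b => rfl
      map_smul' := fun r f => by
        ext γ
        change shiftFun φ (r • f : Fock) γ = r • shiftFun φ f γ
        unfold shiftFun
        cases φ.symm γ with
        | none => simp
        | some b => rfl }
    1 (fun f => by
      rw [one_mul]
      exact lp.norm_le_of_forall_sum_le (by norm_num) (norm_nonneg _) (sum_shiftFun_le φ f))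

theorem shiftOp_apply (φ : Tup ≃. Tup) (f : Fock) (γ : Tup) :
    shiftOp φ f γ = (φ.symm γ).elim 0 f := rfl

theorem inner_e (γ : Tup) (f : Fock) : inner ℂ (e γ) f = f γ := by
  classical
  have h := lp.inner_single_left (𝕜 := ℂ) (G := fun _ : Tup => ℂ) γ 1 f
  rw [e]
  convert h using 1
  simp

theorem e_apply (γ δ : Tup) [Decidable (δ = γ)] : e γ δ = if δ = γ then 1 else 0 := by
  classical
  rw [e, lp.single_apply]
  split_ifs with h
  · subst h; simp
  · simp [h]

theorem shiftOp_e (φ : Tup ≃. Tup) (γ : Tup) : shiftOp φ (e γ) = (φ γ).elim 0 e := by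
  classical
  ext δ
  rw [shiftOp_apply]
  cases hs : φ.symm δ with
  | none =>
    cases hp : φ γ with
    | none => simp
    | some b =>
      have : δ ≠ b := by
        rintro rfl
        rw [(PEquiv.eq_some_iff φ).2 hp] at hs
        cases hs
      simp [e_apply, this]
  | some a =>
    have ha := (PEquiv.eq_some_iff φ).1 hs
    cases hp : φ γ with
    | none =>
      have : a ≠ γ := by rintro rfl; rw [ha] at hp; cases hp
      simp [e_apply, this]
    | some b =>
      have : a = γ ↔ δ = b := by
        constructor
        · rintro rfl; rw [ha] at hp; exact Option.some.inj hp
        · rintro rfl; exact PEquiv.inj φ ha hp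
      simp [e_apply, this]

theorem star_shiftOp_apply (φ : Tup ≃. Tup) (f : Fock) (γ : Tup) :
    (star (shiftOp φ)) f γ = (φ γ).elim 0 f := by
  rw [← inner_e, ContinuousLinearMap.star_eq_adjoint, ContinuousLinearMap.adjoint_inner_right,
    shiftOp_e]
  cases φ γ with
  | none => simp
  | some b => exact inner_e b f

/-- The creator `A_i†`, `i ≥ 1`: `A_i† e_γ = e_i ⊗ e_γ` if `γ = ∅` or `i ≥ i_1`, and
`A_i† e_γ = 0` otherwise. -/
def creator (i : ℕ) : Fock →L[ℂ] Fock := shiftOp (Tup.pushEquiv i)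

/-- The orthogonal projection `P_Ω` onto the vacuum. -/
def vacuumProj : Fock →L[ℂ] Fock := (Submodule.span ℂ {vacuum}).starProjection

theorem norm_vacuum : ‖vacuum‖ = 1 := by
  classical
  rw [vacuum, e, lp.norm_single (by norm_num), norm_one]

theorem vacuumProj_apply (f : Fock) (γ : Tup) [Decidable (γ.head = 0)] :
    vacuumProj f γ = if γ.head = 0 then f γ else 0 := by
  classical
  have hh : γ.head = 0 ↔ γ = Tup.nil := Tup.head_eq_zero
  have h := Submodule.starProjection_unit_singleton ℂ norm_vacuum f
  rw [vacuumProj, h, vacuum, inner_e]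
  change f Tup.nil * e Tup.nil γ = _
  rw [e_apply]
  by_cases hγ : γ = Tup.nil
  · subst hγ; simp [hh]
  · simp [hh, hγ]

/-- The family `z P_Ω, A_1†, A_2†, …`. -/
def family (z : Circle) : ℕ → Fock →L[ℂ] Fock
  | 0 => (z : ℂ) • vacuumProj
  | i + 1 => creator (i + 1)

theorem creator_star_creator {i : ℕ} (hi : 1 ≤ i) (f : Fock) (γ : Tup) :
    (creator i * star (creator i)) f γ = if γ.head = i then f γ else 0 := by
  change shiftOp (Tup.pushEquiv i) (star (shiftOp (Tup.pushEquiv i)) f) γ = _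
  rw [shiftOp_apply]
  have h := Tup.pop_isSome (γ := γ) hi
  change (Tup.pop i γ).elim 0 _ = _
  cases hp : Tup.pop i γ with
  | none =>
    rw [hp] at h
    rw [if_neg fun h' => by simpa using h.2 h']
    rfl
  | some δ =>
    rw [hp] at h
    rw [if_pos (h.1 rfl)]
    change star (shiftOp (Tup.pushEquiv i)) f δ = _
    rw [star_shiftOp_apply]
    change (Tup.push i δ).elim 0 f = _
    rw [Tup.push_eq_some.2 (Tup.pop_eq_some.1 hp)]
    rfl

theorem star_creator_creator {i : ℕ} (hi : 1 ≤ i) (f : Fock) (γ : Tup) :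
    (star (creator i) * creator i) f γ = if γ.head ≤ i then f γ else 0 := by
  change star (shiftOp (Tup.pushEquiv i)) (shiftOp (Tup.pushEquiv i) f) γ = _
  rw [star_shiftOp_apply]
  have h := Tup.push_isSome (i := i) (γ := γ)
  change (Tup.push i γ).elim 0 _ = _
  cases hp : Tup.push i γ with
  | none =>
    rw [hp] at h
    rw [if_neg fun h' => by simpa using h.2 ⟨hi, h'⟩]
    rfl
  | some δ =>
    rw [hp] at h
    rw [if_pos (h.1 rfl).2]
    change shiftOp (Tup.pushEquiv i) f δ = _
    rw [shiftOp_apply]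
    change (Tup.pop i δ).elim 0 f = _
    rw [Tup.pop_eq_some.2 (Tup.push_eq_some.1 hp)]
    rfl

theorem creator_apply_ne {i : ℕ} (hi : 1 ≤ i) (f : Fock) (γ : Tup) (h : γ.head ≠ i) :
    creator i f γ = 0 := by
  change (Tup.pop i γ).elim 0 f = 0
  have h' := Tup.pop_isSome (γ := γ) hi
  cases hp : Tup.pop i γ with
  | none => rfl
  | some δ => rw [hp] at h'; exact (h (h'.1 rfl)).elim

theorem star_vacuumProj : star vacuumProj = vacuumProj :=
  (isSelfAdjoint_starProjection (Submodule.span ℂ {vacuum})).star_eq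

theorem family_mul_star (z : Circle) (k : ℕ) (f : Fock) (γ : Tup) :
    (family z k * star (family z k)) f γ = if γ.head = k then f γ else 0 := by
  cases k with
  | zero =>
    have hz : (z : ℂ) * star (z : ℂ) = 1 := by
      rw [Complex.star_def, Complex.mul_conj, Circle.normSq_coe]; norm_num
    have : family z 0 * star (family z 0) = vacuumProj * vacuumProj := by
      simp only [family, star_smul, star_vacuumProj]
      rw [smul_mul_smul_comm, hz, one_smul]
    rw [this]
    change vacuumProj (vacuumProj f) γ = _
    rw [vacuumProj_apply, vacuumProj_apply]
    split_ifs <;> rfl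
  | succ k => exact creator_star_creator (by omega) f γ

theorem star_mul_family (z : Circle) (k : ℕ) (f : Fock) (γ : Tup) :
    (star (family z k) * family z k) f γ = if γ.head ≤ k then f γ else 0 := by
  cases k with
  | zero =>
    have hz : star (z : ℂ) * (z : ℂ) = 1 := by
      rw [mul_comm, Complex.star_def, Complex.mul_conj, Circle.normSq_coe]; norm_num
    have : star (family z 0) * family z 0 = vacuumProj * vacuumProj := by
      simp only [family, star_smul, star_vacuumProj]
      rw [smul_mul_smul_comm, hz, one_smul]
    rw [this]
    change vacuumProj (vacuumProj f) γ = _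
    rw [vacuumProj_apply, vacuumProj_apply]
    simp only [Nat.le_zero]
    split_ifs <;> rfl
  | succ k => exact star_creator_creator (by omega) f γ

theorem family_apply_ne (z : Circle) (k : ℕ) (f : Fock) (γ : Tup) (h : γ.head ≠ k) :
    family z k f γ = 0 := by
  cases k with
  | zero =>
    change (z : ℂ) * vacuumProj f γ = 0
    rw [vacuumProj_apply, if_neg h, mul_zero]
  | succ k => exact creator_apply_ne (by omega) f γ h

theorem isWMFamily_family (z : Circle) : IsWMFamily (family z) where
  partialIsometry i := by
    ext f γ
    change (family z i * star (family z i)) (family z i f) γ = family z i f γ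
    rw [family_mul_star]
    split_ifs with h
    · rfl
    · exact (family_apply_ne z i f γ h).symm
  orthogonal i j hij := by
    have h : star (family z i) * family z j = 0 := by
      have h1 : family z i * star (family z i) * family z j = 0 := by
        ext f γ
        change (family z i * star (family z i)) (family z j f) γ = 0
        rw [family_mul_star]
        split_ifs with h
        · exact family_apply_ne z j f γ (by omega)
        · rfl
      have h2 : star (star (family z i) * family z j) * (star (family z i) * family z j) = 0 := by
        rw [star_mul, star_star, mul_assoc, ← mul_assoc (family z i), h1, mul_zero]
      exact CStarRing.star_mul_self_eq_zero_iff _ |>.1 h2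
    exact h
  support i := by
    ext f γ
    rw [star_mul_family, _root_.sum_apply, lp.coeFn_sum, Finset.sum_apply]
    simp only [family_mul_star]
    rw [Finset.sum_ite_eq]
    simp only [Finset.mem_range, Nat.lt_succ_iff]

end Fock

/-! ### Representations -/

section Representations

variable {A : Type*} [NonUnitalCStarAlgebra A]
  {H : Type*} [NormedAddCommGroup H] [InnerProductSpace ℂ H] [CompleteSpace H]
  {K : Type*} [NormedAddCommGroup K] [InnerProductSpace ℂ K] [CompleteSpace K]

/-- A representation is irreducible if it is non-zero and has no non-trivial closed
invariant subspace. -/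
def IsIrreducible (π : A →⋆ₙₐ[ℂ] (H →L[ℂ] H)) : Prop :=
  π ≠ 0 ∧ ∀ M : Submodule ℂ H, IsClosed (M : Set H) → (∀ a, ∀ x ∈ M, π a x ∈ M) → M = ⊥ ∨ M = ⊤

/-- Unitary equivalence of representations. -/
def UnitarilyEquivalent (π : A →⋆ₙₐ[ℂ] (H →L[ℂ] H)) (ρ : A →⋆ₙₐ[ℂ] (K →L[ℂ] K)) : Prop :=
  ∃ U : H ≃ₗᵢ[ℂ] K, ∀ a x, U (π a x) = ρ a (U x)

end Representations

/-- The representation `π̃_{0,z}` on the weakly monotone Fock space, with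
`s_0 ↦ z P_Ω` and `s_i ↦ A_i†` for `i ≥ 1`. -/
def piZero (z : Circle) : OA →⋆ₙₐ[ℂ] (Fock →L[ℂ] Fock) := OA.lift (Fock.isWMFamily_family z)

/-- The representation `π̃_{n,z} = π̃_{0,z} ∘ Ψ⁻¹ ∘ p_n` obtained from an isomorphism
`Ψ : O_{A_ℕ} → O_{A_ℕ} / J_n`. -/
def piTilde {n : ℕ} (Ψ : OA ≃⋆ₐ[ℂ] Q n) (z : Circle) : OA →⋆ₙₐ[ℂ] (Fock →L[ℂ] Fock) :=
  (piZero z).comp ((Ψ.symm : Q n →⋆ₙₐ[ℂ] OA).comp (proj n))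

end WM

end

/-! Everything rests on two consequences of the relations: `s_i s_j = 0` for `i < j`, and `s_i* s_i
s_j = s_j` for `j ≤ i`. Hence, on the range of `s_0`, nonzero products of generators with positive
index are words with weakly decreasing letters, adjoints strip the first letter, and words applied
to one unit vector of that range are orthonormal: this is the Fock basis.

Let `π` be irreducible with `π(s_0) ≠ 0`. The case `i = 0` of the support relation makes `π(s_0)` a
normal partial isometry, unitary on its range. If a nonzero closed `K` in that range reduces
`π(s_0)`, the closed span of words on `K` is invariant, hence everything; since `s_0 s_0*`
compresses it into `K`, the whole range lies in `K` (`IsIrreducible.mem_of_reducing`). By functional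
calculus the spectrum has only one nonzero point `z`, and it lies on the circle
(`IsIrreducible.exists_eq_smul`). A unit vector of the range is then an eigenvector, its words form
a Hilbert basis, and sending them to the Fock basis intertwines `π` with `piZero z`.

If `π` kills `s_0, …, s_{n-1}`, the remaining generators satisfy the same relations, because the
missing terms of the support sums vanish. The same remark, with the universal property applied in
both directions, gives `Ψ_n`; this requires `O_A / J_n` to be a C*-algebra. Taking `n` least with
`π(s_n) ≠ 0` reduces the general case to the previous one. Conversely, in `piZero z` adjoints of
creators carry any nonzero coefficient to the vacuum and creators rebuild every basis vector, whence
irreducibility. -/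

noncomputable section

open Finset

namespace WM

/-! ### The C*-norm on the quotient by a closed ideal. -/

section Quotient

open Filter Topology Unitization CStarAlgebra

variable {A : Type*} [NonUnitalCStarAlgebra A]

/-- In the unitization `0 ≤ b* b ≤ 1`, so `0 ≤ 1 - b* b ≤ 1` and left multiplication by `1 - b* b`
is a contraction. -/
theorem norm_sub_star_mul_self_mul_le {b : A} (hb : ‖star b * b‖ ≤ 1) (z : A) :
    ‖z - star b * b * z‖ ≤ ‖z‖ := by
  let _ := CStarAlgebra.spectralOrder (Unitization ℂ A)
  have := CStarAlgebra.spectralOrderedRing (Unitization ℂ A)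
  have h0 : (0 : Unitization ℂ A) ≤ ((star b * b : A) : Unitization ℂ A) := by
    rw [inr_mul, inr_star]; exact star_mul_self_nonneg _
  have h1 : ((star b * b : A) : Unitization ℂ A) ∈ Set.Icc 0 1 :=
    CStarAlgebra.mem_Icc_iff_norm_le_one.2 ⟨h0, by rwa [norm_inr]⟩
  have h2 := (CStarAlgebra.mem_Icc_iff_norm_le_one.1 (Set.sub_mem_Icc_zero_iff_right.2 h1)).2
  rw [← norm_inr (𝕜 := ℂ) (z - _), ← norm_inr (𝕜 := ℂ) z, inr_sub, inr_mul _ (star b * b) z]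
  calc _ = ‖(1 - ((star b * b : A) : Unitization ℂ A)) * (z : Unitization ℂ A)‖ := by
        rw [sub_mul, one_mul]
    _ ≤ _ := (norm_mul_le _ _).trans (mul_le_of_le_one_left (norm_nonneg _) h2)

theorem norm_sub_mul_star_mul_self_le {b : A} (hb : ‖star b * b‖ ≤ 1) (z : A) :
    ‖z - z * (star b * b)‖ ≤ ‖z‖ := by
  have h := norm_sub_star_mul_self_mul_le hb (star z)
  rw [norm_star, ← norm_star] at h
  simpa [mul_assoc] using h

/-- A closed self-adjoint two-sided ideal has approximate right units of the form `b* b`. -/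
theorem exists_approx_unit (J : Submodule ℂ A) (hJ : IsClosed (J : Set A))
    (hl : ∀ a : A, ∀ x ∈ J, a * x ∈ J) (hs : ∀ x ∈ J, star x ∈ J) {j : A} (hj : j ∈ J)
    {ε : ℝ} (hε : 0 < ε) :
    ∃ b : A, star b * b ∈ J ∧ ‖star b * b‖ ≤ 1 ∧ ‖j - j * (star b * b)‖ < ε := by
  -- The ideal is itself a C*-algebra and so has an increasing approximate unit. Recording
  -- positivity as `star b * b` transfers it to `A` without comparing the two orders.
  let B : NonUnitalStarSubalgebra ℂ A :=
    { J with
      mul_mem' := fun _ hb => hl _ _ hb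
      star_mem' := fun ha => hs _ ha }
  have : IsClosed (B : Set A) := hJ
  let _ := CStarAlgebra.spectralOrder B
  have := CStarAlgebra.spectralOrderedRing B
  have hu := CStarAlgebra.increasingApproximateUnit B
  have h1 := hu.tendsto_mul_left ⟨j, hj⟩
  have h2 := (Metric.tendsto_nhds.1 h1) ε hε
  obtain ⟨e, he1, he2, he3⟩ := (h2.and (hu.eventually_nonneg.and hu.eventually_norm)).exists
  obtain ⟨b, rfl⟩ := CStarAlgebra.nonneg_iff_eq_star_mul_self.1 he2
  refine ⟨b, (star b * b).2, he3, ?_⟩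
  rw [dist_comm, dist_eq_norm] at he1
  exact he1

/-- The C*-inequality for the quotient norm. -/
theorem quotient_norm_mul_self_le (J : Submodule ℂ A) (hJ : IsClosed (J : Set A))
    (hl : ∀ a : A, ∀ x ∈ J, a * x ∈ J) (hs : ∀ x ∈ J, star x ∈ J) (x y : A)
    (hxy : star x * x - y ∈ J) :
    ‖(Submodule.Quotient.mk x : A ⧸ J)‖ * ‖(Submodule.Quotient.mk x : A ⧸ J)‖ ≤ ‖y‖ := by
  refine le_of_forall_pos_le_add fun ε hε => ?_
  obtain ⟨b, hbJ, hb1, hb⟩ := exists_approx_unit J hJ hl hs hxy hε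
  set e := star b * b with he
  have hse : star e = e := by simp [he]
  have h1 : ‖(Submodule.Quotient.mk x : A ⧸ J)‖ ≤ ‖x - x * e‖ := by
    have : (Submodule.Quotient.mk x : A ⧸ J) = Submodule.Quotient.mk (x - x * e) := by
      rw [Submodule.Quotient.eq, sub_sub_cancel]; exact hl _ _ hbJ
    rw [this]; exact Submodule.Quotient.norm_mk_le _ _
  set w := star x * x - star x * x * e with hw
  calc _ ≤ ‖x - x * e‖ * ‖x - x * e‖ := mul_self_le_mul_self (norm_nonneg _) h1
    -- C*-identity: `(x - x e)* (x - x e) = w - e w` because `e` is self-adjoint.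
    _ = ‖w - e * w‖ := by
      rw [← CStarRing.norm_star_mul_self]
      congr 1
      rw [star_sub, star_mul, hse, hw]
      noncomm_ring
    _ ≤ ‖w‖ := norm_sub_star_mul_self_mul_le hb1 w
    -- Here `e` was chosen to nearly fix the ideal element `x* x - y` under right multiplication, so
    -- the second summand is smaller than `ε`.
    _ = ‖(y - y * e) + ((star x * x - y) - (star x * x - y) * e)‖ := by
      congr 1; rw [hw]; noncomm_ring
    _ ≤ ‖y - y * e‖ + ε := (norm_add_le _ _).trans (by gcongr)
    _ ≤ ‖y‖ + ε := by gcongr; exact norm_sub_mul_star_mul_self_le hb1 y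

end Quotient

theorem isClosed_closedIdeal {A : Type*} [NonUnitalCStarAlgebra A] (T : Set A) :
    IsClosed (closedIdeal T : Set A) := by
  rw [closedIdeal, Submodule.coe_sInf]
  exact isClosed_biInter fun J hJ => hJ.1

namespace Q

variable {n : ℕ}

instance : IsClosed (idealJ n : Set OA) := isClosed_closedIdeal _

instance : NonUnitalNormedRing (Q n) where
  __ := (inferInstance : NonUnitalRing (Q n))
  __ := (inferInstance : NormedAddCommGroup (Q n))
  norm_mul_le x y := by
    refine le_of_forall_pos_le_add fun ε hε => ?_
    have hlim : Filter.Tendsto (fun δ : ℝ => (‖x‖ + δ) * (‖y‖ + δ)) (nhdsWithin 0 (Set.Ioi 0))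
        (nhds (‖x‖ * ‖y‖)) := by
      have : Continuous fun δ : ℝ => (‖x‖ + δ) * (‖y‖ + δ) := by fun_prop
      simpa using (this.tendsto 0).mono_left nhdsWithin_le_nhds
    obtain ⟨δ, h1, h2⟩ := ((hlim.eventually (eventually_lt_nhds
      (lt_add_of_pos_right _ hε))).and self_mem_nhdsWithin).exists
    obtain ⟨a, rfl, ha⟩ := Submodule.Quotient.norm_mk_lt x h2
    obtain ⟨b, rfl, hb⟩ := Submodule.Quotient.norm_mk_lt y h2
    rw [← mk_mul]
    refine ((Submodule.Quotient.norm_mk_le _ _).trans (norm_mul_le a b)).trans (le_trans ?_ h1.le)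
    exact mul_le_mul ha.le hb.le (norm_nonneg _) ((norm_nonneg _).trans ha.le)

/-- This makes the universal property and automatic continuity available with target `O_A / J_n`.
The C*-inequality follows by letting `y` run over representatives of the class of `a* a` with norm
close to the quotient norm. -/
instance : NonUnitalCStarAlgebra (Q n) where
  __ := (inferInstance : CompleteSpace (Q n))
  __ := (inferInstance : NormedSpace ℂ (Q n))
  __ := (inferInstance : IsScalarTower ℂ (Q n) (Q n))
  __ := (inferInstance : SMulCommClass ℂ (Q n) (Q n))
  __ := (inferInstance : StarModule ℂ (Q n))
  norm_mul_self_le x := by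
    obtain ⟨a, rfl⟩ := Submodule.Quotient.mk_surjective _ x
    rw [← mk_star, ← mk_mul]
    refine le_of_forall_pos_le_add fun ε hε => ?_
    obtain ⟨y, hy, hy'⟩ :=
      Submodule.Quotient.norm_mk_lt (Submodule.Quotient.mk (star a * a) : Q n) hε
    refine (quotient_norm_mul_self_le (idealJ n) inferInstance (fun a x hx => idealJ_mul_left a hx)
      (fun x hx => idealJ_star hx) a y ?_).trans hy'.le
    exact (Submodule.Quotient.eq _).1 hy.symm

end Q

theorem continuous_hom {A B : Type*} [NonUnitalCStarAlgebra A] [NonUnitalCStarAlgebra B]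
    (φ : A →⋆ₙₐ[ℂ] B) : Continuous φ :=
  AddMonoidHomClass.continuous_of_bound φ 1 fun a => by
    rw [one_mul]; exact NonUnitalStarAlgHom.norm_apply_le φ a

theorem proj_surjective (n : ℕ) : Function.Surjective (proj n) :=
  Submodule.Quotient.mk_surjective _

theorem proj_eq_zero {n : ℕ} {x : OA} : proj n x = 0 ↔ x ∈ idealJ n :=
  Submodule.Quotient.mk_eq_zero _

theorem proj_s_of_lt {i n : ℕ} (h : i < n) : proj n (OA.s i) = 0 := by
  rw [proj_eq_zero, idealJ, closedIdeal, Submodule.mem_sInf]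
  exact fun I hI => hI.2.2 ⟨i, h, rfl⟩

namespace OA

/-- A closed property of elements of `O_{A_ℕ}` which is stable under the operations of a
`*`-algebra holds everywhere if it holds for the generators. -/
theorem induction {P : OA → Prop} (hc : IsClosed {x | P x}) (hs : ∀ i, P (s i)) (h0 : P 0)
    (hadd : ∀ a b, P a → P b → P (a + b)) (hmul : ∀ a b, P a → P b → P (a * b))
    (hsmul : ∀ (r : ℂ) a, P a → P (r • a)) (hstar : ∀ a, P a → P (star a)) (x : OA) : P x := by
  refine ind x hc fun a => ?_
  induction a using Free.induction with
  | hgen i => exact hs i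
  | h0 => exact h0
  | hadd a b ha hb => rw [coe_add]; exact hadd _ _ ha hb
  | hmul a b ha hb => rw [coe_mul]; exact hmul _ _ ha hb
  | hsmul r a ha => rw [coe_smul]; exact hsmul _ _ ha
  | hstar a ha => rw [coe_star]; exact hstar _ ha

theorem hom_ext {A : Type*} [NonUnitalCStarAlgebra A] {φ ψ : OA →⋆ₙₐ[ℂ] A}
    (h : ∀ i, φ (s i) = ψ (s i)) : φ = ψ := by
  ext x
  refine induction (isClosed_eq (continuous_hom φ) (continuous_hom ψ)) h (by simp)
    (fun a b ha hb => by rw [map_add, map_add, ha, hb])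
    (fun a b ha hb => by rw [map_mul, map_mul, ha, hb])
    (fun r a ha => by rw [map_smul, map_smul, ha])
    (fun a ha => by rw [map_star, map_star, ha]) x

end OA

/-! ### Shifting the generators and the isomorphism `Ψ_n`. -/

namespace IsWMFamily

variable {A B : Type*} [NonUnitalRing A] [StarRing A] [NonUnitalRing B] [StarRing B] {S : ℕ → A}

theorem map {F : Type*} [FunLike F A B] [NonUnitalRingHomClass F A B] [StarHomClass F A B]
    (hS : IsWMFamily S) (φ : F) : IsWMFamily fun i => φ (S i) where
  partialIsometry i := by rw [← map_star, ← map_mul, ← map_mul, hS.partialIsometry]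
  orthogonal i j h := by rw [← map_star, ← map_mul, hS.orthogonal i j h, map_zero]
  support i := by simp only [← map_star, ← map_mul, ← map_sum, hS.support]

/-- The tail of a family whose first `n` members vanish. -/
theorem tail (hS : IsWMFamily S) {n : ℕ} (h0 : ∀ i < n, S i = 0) :
    IsWMFamily fun i => S (i + n) where
  partialIsometry i := hS.partialIsometry _
  orthogonal i j h := hS.orthogonal _ _ (by omega)
  support i := by
    -- Of the `n + (i + 1)` range projections the first `n` vanish; the others are exactly those of
    -- the shifted family.
    rw [hS.support, show i + n + 1 = n + (i + 1) by omega, sum_range_add,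
      sum_eq_zero fun k hk => by rw [h0 k (mem_range.1 hk), zero_mul], zero_add]
    simp only [add_comm n]

/-- Prepending `n` zeros to a family. -/
theorem cons_zeros (hS : IsWMFamily S) (n : ℕ) :
    IsWMFamily fun i => if i < n then 0 else S (i - n) where
  partialIsometry i := by
    split_ifs
    · simp
    · exact hS.partialIsometry _
  orthogonal i j h := by
    split_ifs
    · simp
    · simp
    · simp
    · exact hS.orthogonal _ _ (by omega)
  support i := by
    split_ifs with h
    · rw [star_zero, zero_mul, sum_eq_zero]
      intro k hk
      rw [if_pos (by rw [mem_range] at hk; omega), zero_mul]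
    · rw [hS.support, show range (i + 1) = range (n + (i - n + 1)) by congr 1; omega,
        sum_range_add _ n, sum_eq_zero (s := range n) fun k hk => by rw [if_pos (mem_range.1 hk), zero_mul], zero_add]
      refine sum_congr rfl fun k _ => ?_
      rw [if_neg (by omega), Nat.add_sub_cancel_left]

end IsWMFamily

/-- The endomorphism of `O_{A_ℕ}` with `s_i ↦ 0` for `i < n` and `s_i ↦ s_{i - n}` for `i ≥ n`. -/
def unshift (n : ℕ) : OA →⋆ₙₐ[ℂ] OA := OA.lift (OA.isWMFamily_s.cons_zeros n)

theorem unshift_s (n i : ℕ) : unshift n (OA.s i) = if i < n then 0 else OA.s (i - n) :=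
  OA.lift_s _ i

/-- The kernel is a closed two-sided ideal containing the generators of `J_n`, hence contains `J_n`.
-/
theorem unshift_eq_zero {n : ℕ} {x : OA} (hx : x ∈ idealJ n) : unshift n x = 0 := by
  rw [idealJ, closedIdeal, Submodule.mem_sInf] at hx
  refine hx (LinearMap.ker (unshift n : OA →ₗ[ℂ] OA)) ⟨?_, fun a x hx => ⟨?_, ?_⟩, ?_⟩
  · exact isClosed_eq (continuous_hom (unshift n)) continuous_const
  · change unshift n (a * x) = 0
    rw [map_mul, show unshift n x = 0 from hx, mul_zero]
  · change unshift n (x * a) = 0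
    rw [map_mul, show unshift n x = 0 from hx, zero_mul]
  · rintro _ ⟨i, hi, rfl⟩
    exact (unshift_s n i).trans (if_pos hi)

/-- `O_{A_ℕ} → O_{A_ℕ} / J_n`, `s_i ↦ p_n(s_{i+n})`. -/
def shiftHom (n : ℕ) : OA →⋆ₙₐ[ℂ] Q n :=
  OA.lift ((OA.isWMFamily_s.map (proj n)).tail fun _ hi => proj_s_of_lt hi)

theorem shiftHom_s (n i : ℕ) : shiftHom n (OA.s i) = proj n (OA.s (i + n)) := OA.lift_s _ i

/-- Agreement on generators suffices. Since `proj n` is onto, this yields surjectivity of `shiftHom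
n`. -/
theorem shiftHom_unshift (n : ℕ) (x : OA) : shiftHom n (unshift n x) = proj n x := by
  refine DFunLike.congr_fun (f := (shiftHom n).comp (unshift n)) (OA.hom_ext fun i => ?_) x
  change shiftHom n (unshift n (OA.s i)) = _
  rw [unshift_s]
  split_ifs with h
  · rw [map_zero, proj_s_of_lt h]
  · rw [shiftHom_s, Nat.sub_add_cancel (by omega)]

/-- The map `O_{A_ℕ} / J_n → O_{A_ℕ}` induced by `unshift n`. -/
def unshiftQ (n : ℕ) : Q n →ₗ[ℂ] OA :=
  (idealJ n).liftQ (unshift n : OA →ₗ[ℂ] OA) fun _ hx => unshift_eq_zero hx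

theorem unshiftQ_proj (n : ℕ) (x : OA) : unshiftQ n (proj n x) = unshift n x := rfl

theorem unshiftQ_shiftHom (n : ℕ) (x : OA) : unshiftQ n (shiftHom n x) = x := by
  -- The linear map `unshiftQ n` is upgraded to a `*`-homomorphism so that its composite with
  -- `shiftHom n` can be compared with the identity on generators.
  let θ : Q n →⋆ₙₐ[ℂ] OA :=
    { unshiftQ n with
      map_zero' := map_zero _
      map_mul' := fun a b => by
        obtain ⟨a, rfl⟩ := proj_surjective n a
        obtain ⟨b, rfl⟩ := proj_surjective n b
        exact map_mul (unshift n) a b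
      map_star' := fun a => by
        obtain ⟨a, rfl⟩ := proj_surjective n a
        exact map_star (unshift n) a }
  refine DFunLike.congr_fun (f := θ.comp (shiftHom n)) (g := NonUnitalStarAlgHom.id ℂ OA)
    (OA.hom_ext fun i => ?_) x
  change unshiftQ n (shiftHom n (OA.s i)) = OA.s i
  rw [shiftHom_s, unshiftQ_proj, unshift_s, if_neg (by omega), Nat.add_sub_cancel]

/-- The isomorphism `Ψ_n`. -/
def shiftEquiv (n : ℕ) : OA ≃⋆ₐ[ℂ] Q n :=
  StarAlgEquiv.ofBijective (shiftHom n)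
    ⟨Function.LeftInverse.injective (unshiftQ_shiftHom n), fun y => by
      obtain ⟨x, rfl⟩ := proj_surjective n y
      exact ⟨_, shiftHom_unshift n x⟩⟩

theorem existsUnique_shiftEquiv (n : ℕ) :
    ∃! Ψ : OA ≃⋆ₐ[ℂ] Q n, ∀ i, Ψ (OA.s i) = proj n (OA.s (i + n)) := by
  refine ⟨shiftEquiv n, fun i => shiftHom_s n i, fun Ψ hΨ => ?_⟩
  have h : (Ψ : OA →⋆ₙₐ[ℂ] Q n) = shiftHom n :=
    OA.hom_ext fun i => (hΨ i).trans (shiftHom_s n i).symm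
  ext x
  exact DFunLike.congr_fun h x

/-- Thus `π̃_{n,z}` is `piZero z` composed with `unshift n`, and the quotient disappears from later
arguments. -/
theorem symm_proj_eq_unshift {n : ℕ} {Ψ : OA ≃⋆ₐ[ℂ] Q n}
    (hΨ : ∀ i, Ψ (OA.s i) = proj n (OA.s (i + n))) (x : OA) : Ψ.symm (proj n x) = unshift n x := by
  have h : (Ψ : OA →⋆ₙₐ[ℂ] Q n) = shiftHom n :=
    OA.hom_ext fun i => (hΨ i).trans (shiftHom_s n i).symm
  rw [← shiftHom_unshift, ← h]
  exact Ψ.symm_apply_apply _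

/-! ### Families of operators and words -/

/-- The vector `S_{i_1} ⋯ S_{i_k} x`. -/
def word {H : Type*} [NormedAddCommGroup H] [InnerProductSpace ℂ H] (S : ℕ → H →L[ℂ] H) (γ : Tup)
    (x : H) : H := γ.val.foldr (fun i v => S i v) x

theorem Tup.exists_push {γ : Tup} (h : γ.head ≠ 0) : ∃ δ, push γ.head δ = some γ := by
  have := (pop_isSome (γ := γ) (Nat.one_le_iff_ne_zero.2 h)).2 rfl
  obtain ⟨δ, hδ⟩ := Option.isSome_iff_exists.1 this
  exact ⟨δ, push_eq_some.2 (pop_eq_some.1 hδ)⟩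

theorem Tup.head_of_push {i : ℕ} {γ δ : Tup} (h : push i γ = some δ) : δ.head = i := by
  rw [head, push_eq_some.1 h]; rfl

theorem Tup.induction {P : Tup → Prop} (hnil : P nil)
    (hpush : ∀ i γ δ, push i γ = some δ → P γ → P δ) (γ : Tup) : P γ := by
  obtain ⟨l, hs, hp⟩ := γ
  induction l with
  | nil => exact hnil
  | cons i l ih =>
    exact hpush i _ _ (push_eq_some.2 rfl)
      (ih (List.pairwise_cons.1 hs).2 fun j hj => hp j (List.mem_cons_of_mem _ hj))

section Words

variable {H : Type*} [NormedAddCommGroup H] [InnerProductSpace ℂ H]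
  {S : ℕ → H →L[ℂ] H}

@[simp] theorem word_nil (x : H) : word S Tup.nil x = x := rfl

theorem word_of_push {i : ℕ} {γ δ : Tup} (h : Tup.push i γ = some δ) (x : H) :
    word S δ x = S i (word S γ x) := by
  rw [word, Tup.push_eq_some.1 h]; rfl

theorem word_smul (γ : Tup) (c : ℂ) (x : H) : word S γ (c • x) = c • word S γ x := by
  induction γ using Tup.induction with
  | hnil => rfl
  | hpush i γ δ h ih => rw [word_of_push h, word_of_push h, ih, map_smul]

variable [CompleteSpace H] (hS : IsWMFamily S)
include hS

theorem IsWMFamily.star_apply_ne {i j : ℕ} (h : i ≠ j) (x : H) : star (S i) (S j x) = 0 :=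
  DFunLike.congr_fun (hS.orthogonal i j h) x

theorem IsWMFamily.self_star_self_apply (i : ℕ) (x : H) : S i (star (S i) (S i x)) = S i x :=
  DFunLike.congr_fun (hS.partialIsometry i) x

theorem IsWMFamily.star_self_apply (i : ℕ) (x : H) :
    star (S i) (S i x) = ∑ k ∈ range (i + 1), S k (star (S k) x) := by
  have h := DFunLike.congr_fun (hS.support i) x
  rw [_root_.sum_apply] at h
  exact h

/-- The initial projection of `S i` is the sum of the range projections of index at most `i`; on the
range of `S j` only the `j`-th one survives. -/
theorem IsWMFamily.star_self_apply_of_le {i j : ℕ} (h : j ≤ i) (x : H) :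
    star (S i) (S i (S j x)) = S j x := by
  rw [hS.star_self_apply, sum_eq_single j, hS.self_star_self_apply]
  · intro k _ hk
    rw [hS.star_apply_ne hk, map_zero]
  · intro hj
    exact (hj (mem_range.2 (by omega))).elim

/-- The range of `S j` is orthogonal to every range of index at most `i`, hence to the initial space
of `S i`. This is the weakly monotone condition. -/
theorem IsWMFamily.apply_of_lt {i j : ℕ} (h : i < j) (x : H) : S i (S j x) = 0 := by
  rw [← hS.self_star_self_apply, hS.star_self_apply, sum_eq_zero, map_zero]
  intro k hk
  rw [hS.star_apply_ne (by rw [mem_range] at hk; omega), map_zero]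

theorem IsWMFamily.isStarNormal_zero : IsStarNormal (S 0) :=
  ⟨by rw [Commute, SemiconjBy, hS.support 0, sum_range_one]⟩

-- The convention that the empty tuple has head `0` lets the empty word fit the pattern: `x` lies in
-- the range of `S 0`.
omit [CompleteSpace H] hS in
theorem exists_word_eq {x : H} (hx : ∃ y, S 0 y = x) (γ : Tup) : ∃ y, S γ.head y = word S γ x := by
  induction γ using Tup.induction with
  | hnil => exact hx
  | hpush i γ δ h _ => exact ⟨word S γ x, by rw [word_of_push h, Tup.head_of_push h]⟩

theorem IsWMFamily.star_word_of_ne {x : H} (hx : ∃ y, S 0 y = x) {i : ℕ} {γ : Tup}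
    (h : γ.head ≠ i) : star (S i) (word S γ x) = 0 := by
  obtain ⟨y, hy⟩ := exists_word_eq hx γ
  rw [← hy, hS.star_apply_ne h.symm]

theorem IsWMFamily.word_of_lt {x : H} (hx : ∃ y, S 0 y = x) {i : ℕ} {γ : Tup}
    (h : i < γ.head) : S i (word S γ x) = 0 := by
  obtain ⟨y, hy⟩ := exists_word_eq hx γ
  rw [← hy, hS.apply_of_lt h]

theorem IsWMFamily.star_word_of_push {x : H} (hx : ∃ y, S 0 y = x) {i : ℕ} {γ δ : Tup}
    (h : Tup.push i γ = some δ) : star (S i) (word S δ x) = word S γ x := by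
  rw [word_of_push h]
  obtain ⟨y, hy⟩ := exists_word_eq hx γ
  have h' : γ.head ≤ i := (Tup.push_isSome.1 (by rw [h]; rfl)).2
  rw [← hy, hS.star_self_apply_of_le h']

/-- Induction on the left tuple with the right one arbitrary: the first letter moves across the
inner product as an adjoint, where it either strips an equal first letter or annihilates the word.
-/
theorem IsWMFamily.orthonormal_word {x : H} (hx : ∃ y, S 0 y = x) (h1 : ‖x‖ = 1) :
    Orthonormal ℂ fun γ => word S γ x := by
  classical
  rw [orthonormal_iff_ite]
  intro γ
  induction γ using Tup.induction with
  | hnil =>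
    intro δ
    split_ifs with h
    · rw [← h, word_nil, inner_self_eq_norm_sq_to_K, h1]; simp
    · obtain ⟨y, rfl⟩ := hx
      obtain ⟨v, hv⟩ := exists_word_eq ⟨y, rfl⟩ δ
      rw [word_nil, ← hv, ← ContinuousLinearMap.adjoint_inner_right,
        ← ContinuousLinearMap.star_eq_adjoint, hS.star_apply_ne, inner_zero_right]
      intro h0
      exact h (Tup.head_eq_zero.1 h0.symm).symm
  | hpush i γ γ' hγ ih =>
    intro δ'
    rw [word_of_push hγ, ← ContinuousLinearMap.adjoint_inner_right,
      ← ContinuousLinearMap.star_eq_adjoint]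
    by_cases h : δ'.head = i
    · have hi := (Tup.push_isSome.1 (Option.isSome_of_mem hγ)).1
      obtain ⟨δ, hδ⟩ := Tup.exists_push (γ := δ') (by omega)
      rw [h] at hδ
      rw [hS.star_word_of_push hx hδ, ih]
      have : γ = δ ↔ γ' = δ' := by
        rw [Tup.push_eq_some] at hγ hδ
        rw [Tup.ext_iff, Tup.ext_iff, hγ, hδ, List.cons.injEq]
        simp
      simp only [this]
    · rw [hS.star_word_of_ne hx h, inner_zero_right, if_neg]
      rintro rfl
      exact h (Tup.head_of_push hγ)

end Words

/-! ### Invariant subspaces generated from the range of `s_0`. -/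

section Irreducible

variable {H : Type*} [NormedAddCommGroup H] [InnerProductSpace ℂ H]

theorem mapsTo_topologicalClosure_span (T : H →L[ℂ] H) {s : Set H} {N : Submodule ℂ H}
    (hN : IsClosed (N : Set H)) (h : ∀ v ∈ s, T v ∈ N) :
    ∀ v ∈ (Submodule.span ℂ s).topologicalClosure, T v ∈ N := by
  have h1 : (Submodule.span ℂ s).topologicalClosure ≤ N.comap (T : H →ₗ[ℂ] H) :=
    Submodule.topologicalClosure_minimal _ (Submodule.span_le.2 h) (hN.preimage T.continuous)
  exact fun v hv => h1 hv

/-- The closed span of the words applied to the vectors of `K`. -/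
def wordSpan (S : ℕ → H →L[ℂ] H) (K : Submodule ℂ H) : Submodule ℂ H :=
  (Submodule.span ℂ {v | ∃ γ, ∃ x ∈ K, word S γ x = v}).topologicalClosure

theorem word_mem_wordSpan (S : ℕ → H →L[ℂ] H) {K : Submodule ℂ H} (γ : Tup) {x : H}
    (hx : x ∈ K) : word S γ x ∈ wordSpan S K :=
  Submodule.le_topologicalClosure _ (Submodule.subset_span ⟨γ, x, hx, rfl⟩)

theorem isClosed_wordSpan (S : ℕ → H →L[ℂ] H) (K : Submodule ℂ H) :
    IsClosed (wordSpan S K : Set H) := Submodule.isClosed_topologicalClosure _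

variable [CompleteSpace H]

/-- A letter is either prepended to a word or kills it. The exception is `S 0` on the empty word,
which is why `K` must be stable under `S 0`. -/
theorem IsWMFamily.apply_mem_wordSpan {S : ℕ → H →L[ℂ] H} (hS : IsWMFamily S) {K : Submodule ℂ H}
    (hK : ∀ x ∈ K, ∃ y, S 0 y = x) (h1 : ∀ x ∈ K, S 0 x ∈ K) (i : ℕ) :
    ∀ v ∈ wordSpan S K, S i v ∈ wordSpan S K := by
  refine mapsTo_topologicalClosure_span _ (isClosed_wordSpan S K) ?_
  rintro _ ⟨γ, x, hx, rfl⟩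
  by_cases h : γ.head ≤ i
  · rcases Nat.eq_zero_or_pos i with rfl | hi
    · obtain rfl := Tup.head_eq_zero.1 (Nat.le_zero.1 h)
      exact word_mem_wordSpan S Tup.nil (h1 x hx)
    · obtain ⟨δ, hδ⟩ := Option.isSome_iff_exists.1 (Tup.push_isSome.2 ⟨hi, h⟩)
      rw [← word_of_push hδ]
      exact word_mem_wordSpan S δ hx
  · rw [hS.word_of_lt (hK x hx) (not_le.1 h)]
    exact zero_mem _

theorem IsWMFamily.star_apply_mem_wordSpan {S : ℕ → H →L[ℂ] H} (hS : IsWMFamily S)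
    {K : Submodule ℂ H} (hK : ∀ x ∈ K, ∃ y, S 0 y = x) (h1 : ∀ x ∈ K, star (S 0) x ∈ K) (i : ℕ) :
    ∀ v ∈ wordSpan S K, star (S i) v ∈ wordSpan S K := by
  refine mapsTo_topologicalClosure_span _ (isClosed_wordSpan S K) ?_
  rintro _ ⟨γ, x, hx, rfl⟩
  by_cases h : γ.head = i
  · by_cases hi : i = 0
    · subst hi
      obtain rfl := Tup.head_eq_zero.1 h
      exact word_mem_wordSpan S Tup.nil (h1 x hx)
    · obtain ⟨δ, hδ⟩ := Tup.exists_push (γ := γ) (by omega)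
      rw [h] at hδ
      rw [hS.star_word_of_push (hK x hx) hδ]
      exact word_mem_wordSpan S δ hx
  · rw [hS.star_word_of_ne (hK x hx) h]
    exact zero_mem _

variable {π : OA →⋆ₙₐ[ℂ] (H →L[ℂ] H)}

/-- A closed subspace reducing for all `π(s_i)` is invariant. -/
theorem invariant_of_generators {M : Submodule ℂ H} (hM : IsClosed (M : Set H))
    (h1 : ∀ i, ∀ x ∈ M, π (OA.s i) x ∈ M) (h2 : ∀ i, ∀ x ∈ M, star (π (OA.s i)) x ∈ M) (a : OA) :
    ∀ x ∈ M, π a x ∈ M := by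
  -- Treating `a` and `star a` together makes the statement stable under the star step of the
  -- induction.
  have key : ∀ x ∈ M, π a x ∈ M ∧ π (star a) x ∈ M := by
    have hc := continuous_hom π
    induction a using OA.induction with
    | hc =>
      simp only [Set.ofPred_forall, Set.ofPred_and]
      refine isClosed_iInter fun x => isClosed_iInter fun _ => IsClosed.inter ?_ ?_
      · exact hM.preimage (by fun_prop : Continuous fun a : OA => π a x)
      · exact hM.preimage (by fun_prop : Continuous fun a : OA => π (star a) x)
    | hs i => exact fun x hx => ⟨h1 i x hx, by rw [map_star]; exact h2 i x hx⟩
    | h0 => simp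
    | hadd a b ha hb =>
      intro x hx
      rw [star_add, map_add, map_add]
      exact ⟨M.add_mem (ha x hx).1 (hb x hx).1, M.add_mem (ha x hx).2 (hb x hx).2⟩
    | hmul a b ha hb =>
      intro x hx
      rw [star_mul, map_mul, map_mul]
      exact ⟨(ha _ (hb x hx).1).1, (hb _ (ha x hx).2).2⟩
    | hsmul r a ha =>
      intro x hx
      rw [star_smul, map_smul, map_smul]
      exact ⟨M.smul_mem _ (ha x hx).1, M.smul_mem _ (ha x hx).2⟩
    | hstar a ha =>
      intro x hx
      rw [star_star]
      exact (ha x hx).symm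
  exact fun x hx => (key x hx).1

theorem isWMFamily_image (π : OA →⋆ₙₐ[ℂ] (H →L[ℂ] H)) : IsWMFamily fun i => π (OA.s i) :=
  OA.isWMFamily_s.map π

theorem IsIrreducible.wordSpan_eq_top (hπ : IsIrreducible π) {K : Submodule ℂ H} (hK0 : K ≠ ⊥)
    (hK : ∀ x ∈ K, ∃ y, π (OA.s 0) y = x) (h1 : ∀ x ∈ K, π (OA.s 0) x ∈ K)
    (h2 : ∀ x ∈ K, star (π (OA.s 0)) x ∈ K) : wordSpan (fun i => π (OA.s i)) K = ⊤ := by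
  have hS := isWMFamily_image π
  refine (hπ.2 _ (isClosed_wordSpan _ K) (invariant_of_generators (isClosed_wordSpan _ K)
    (hS.apply_mem_wordSpan hK h1) (hS.star_apply_mem_wordSpan hK h2))).resolve_left fun h => hK0 ?_
  rw [eq_bot_iff, ← h]
  exact fun x hx => word_mem_wordSpan _ Tup.nil hx

/-- The restriction of `π(s_0)` to its range has no reducing subspaces. -/
theorem IsIrreducible.mem_of_reducing (hπ : IsIrreducible π) {K : Submodule ℂ H} (hK0 : K ≠ ⊥)
    (hKc : IsClosed (K : Set H))
    (hK : ∀ x ∈ K, ∃ y, π (OA.s 0) y = x) (h1 : ∀ x ∈ K, π (OA.s 0) x ∈ K)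
    (h2 : ∀ x ∈ K, star (π (OA.s 0)) x ∈ K) (y : H) : π (OA.s 0) y ∈ K := by
  have hS := isWMFamily_image π
  have htop := hπ.wordSpan_eq_top hK0 hK h1 h2
  -- The range projection of `π(s_0)` kills nonempty words and sends `K` to `K`; as the words span
  -- everything, it sends the whole space into `K`.
  have h3 : ∀ v ∈ wordSpan (fun i => π (OA.s i)) K,
      (π (OA.s 0) * star (π (OA.s 0))) v ∈ K := by
    refine mapsTo_topologicalClosure_span _ hKc ?_
    rintro _ ⟨γ, x, hx, rfl⟩
    change π (OA.s 0) (star (π (OA.s 0)) _) ∈ K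
    by_cases h : γ.head = 0
    · obtain rfl := Tup.head_eq_zero.1 h
      exact h1 _ (h2 _ hx)
    · rw [hS.star_word_of_ne (hK x hx) h, map_zero]
      exact zero_mem _
  have h4 := h3 (π (OA.s 0) y) (by rw [htop]; trivial)
  have h5 := hS.self_star_self_apply 0 y
  rw [← h5]
  exact h4

end Irreducible

/-! ### The spectrum of `π(s_0)`. -/

section Irreducible

variable {H : Type*} [NormedAddCommGroup H] [InnerProductSpace ℂ H] [CompleteSpace H]
  {π : OA →⋆ₙₐ[ℂ] (H →L[ℂ] H)}

/-- The product of `cfc f π(s_0)` and `cfc g π(s_0)` can vanish only if one of the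
factors does, for functions `f` and `g` which vanish at `0`. -/
theorem IsIrreducible.cfc_eq_zero_or (hπ : IsIrreducible π) {f g : ℂ → ℂ} (hf : Continuous f)
    (hg : Continuous g) (hfg : ∀ x, f x * x * (g x * x) = 0) :
    cfc (fun x => f x * x) (π (OA.s 0)) = 0 ∨ cfc (fun x => g x * x) (π (OA.s 0)) = 0 := by
  have hS := isWMFamily_image π
  have hn : IsStarNormal (π (OA.s 0)) := hS.isStarNormal_zero
  set a := π (OA.s 0) with ha
  set F := cfc (fun x => f x * x) a with hF
  set G := cfc (fun x => g x * x) a with hG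
  have hFa : F = cfc f a * a := by
    rw [hF, cfc_mul f (fun x => x) a, cfc_id' ℂ a]
  have hGa : G = a * cfc g a := by
    have := (cfc_commute_cfc g (fun x => x) a).eq
    rw [cfc_id' ℂ a] at this
    rw [hG, cfc_mul g (fun x => x) a, cfc_id' ℂ a, this]
  have hFG : F * G = 0 := by
    rw [hF, hG, ← cfc_mul _ _ a]
    simp only [hfg]
    exact cfc_const_zero ℂ a
  have hc1 : F * a = a * F := by
    have := (cfc_commute_cfc (fun x => f x * x) (fun x => x) a).eq
    rwa [cfc_id' ℂ a] at this
  have hc2 : F * star a = star a * F := by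
    have := (cfc_commute_cfc (fun x => f x * x) (fun x => star x) a).eq
    rwa [cfc_star_id a] at this
  have hrange : ∀ x, a (star a x) = x → ∃ y, a y = x := fun x hx => ⟨_, hx⟩
  have hpart : ∀ x, a (star a (a x)) = a x := hS.self_star_self_apply 0
  have hnorm : ∀ x, star a (a x) = a (star a x) := fun x => DFunLike.congr_fun hn.star_comm_self x
  -- The part of `ker F` inside the range of `a`. It reduces `a`, since `F` commutes with `a` and
  -- `star a`. Because `F G = 0` and `G` maps into the range of `a`, the range of `G` lies in `K`;
  -- so `K = 0` kills `G`, and otherwise `K` contains the range of `a`, which kills `F`.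
  let K : Submodule ℂ H :=
    LinearMap.ker (F : H →ₗ[ℂ] H) ⊓ LinearMap.ker ((a * star a - 1 : H →L[ℂ] H) : H →ₗ[ℂ] H)
  have hmem : ∀ x, x ∈ K ↔ F x = 0 ∧ a (star a x) = x := fun x => by
    refine and_congr Iff.rfl ?_
    change a (star a x) - x = 0 ↔ _
    rw [sub_eq_zero]
  have hKc : IsClosed (K : Set H) :=
    (isClosed_eq F.continuous continuous_const).inter
      (isClosed_eq (a * star a - 1 : H →L[ℂ] H).continuous continuous_const)
  by_cases hK : K = ⊥
  · right
    ext x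
    have : G x ∈ K := (hmem _).2 ⟨DFunLike.congr_fun hFG x, by
      rw [hGa]; exact hpart _⟩
    rw [hK] at this
    exact this
  · left
    ext x
    have h1 : a x ∈ K := by
      refine hπ.mem_of_reducing hK hKc (fun x hx => hrange x ((hmem x).1 hx).2) ?_ ?_ x
      · intro x hx
        obtain ⟨h1, h2⟩ := (hmem x).1 hx
        refine (hmem _).2 ⟨?_, hpart x⟩
        have := DFunLike.congr_fun hc1 x
        change F (a x) = a (F x) at this
        rw [this, h1, map_zero]
      · intro x hx
        obtain ⟨h1, h2⟩ := (hmem x).1 hx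
        refine (hmem _).2 ⟨?_, ?_⟩
        · have := DFunLike.congr_fun hc2 x
          change F (star a x) = star a (F x) at this
          rw [this, h1, map_zero]
        · change a (star a (star a x)) = star a x
          rw [← hnorm, h2]
    have h2 : a (F x) = 0 := by
      have := DFunLike.congr_fun hc1 x
      change F (a x) = a (F x) at this
      rw [← this]
      exact ((hmem _).1 h1).1
    have h3 : F = a * cfc f a := by
      rw [hFa]
      have := (cfc_commute_cfc f (fun x => x) a).eq
      rwa [cfc_id' ℂ a] at this
    -- The extra factor `x` in `f x * x` puts `F x` in the range of `a`, where `star a * a` is the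
    -- identity.
    have h4 : F x = star a (a (F x)) := by
      rw [hnorm, h3]
      exact (hpart _).symm
    rw [h4, h2, map_zero]; rfl

/-- The partial isometry identity puts the spectrum in the unit circle together with `0`. Two
distinct nonzero spectral points would be separated by bumps with product zero, so the spectrum lies
in `{0, z}`, where `x = z * (x * star x)`. -/
theorem IsIrreducible.exists_eq_smul (hπ : IsIrreducible π) (h0 : π (OA.s 0) ≠ 0) :
    ∃ z : Circle, π (OA.s 0) = (z : ℂ) • (π (OA.s 0) * star (π (OA.s 0))) := by
  have hS := isWMFamily_image π
  have hn : IsStarNormal (π (OA.s 0)) := hS.isStarNormal_zero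
  have hpi := hS.partialIsometry 0
  have hcz := fun {f g : ℂ → ℂ} => hπ.cfc_eq_zero_or (f := f) (g := g)
  generalize π (OA.s 0) = a at *
  have haa : a * star a = cfc (fun x : ℂ => x * star x) a := by
    rw [cfc_mul (fun x => x) (fun x => star x) a, cfc_id' ℂ a, cfc_star_id a]
  have hspec : ∀ x ∈ spectrum ℂ a, x * star x * x = x := by
    have h : cfc (fun x : ℂ => x * star x * x) a = cfc (fun x : ℂ => x) a := by
      rw [cfc_mul (fun x => x * star x) (fun x => x) a, ← haa, cfc_id' ℂ a]
      exact hpi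
    exact (cfc_eq_cfc_iff_eqOn (R := ℂ) (a := a)).1 h
  have hval : ∀ {f : ℂ → ℂ}, Continuous f → cfc f a = 0 → ∀ x ∈ spectrum ℂ a, f x = 0 := by
    intro f hf h
    rw [← cfc_const_zero ℂ a] at h
    exact (cfc_eq_cfc_iff_eqOn (R := ℂ) (a := a) (hf := hf.continuousOn)).1 h
  obtain ⟨z, hz, hz0⟩ : ∃ z ∈ spectrum ℂ a, z ≠ 0 := by
    by_contra! h
    apply h0
    rw [← cfc_id' ℂ a, ← cfc_const_zero ℂ a]
    exact cfc_congr h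
  have hzs : z * star z = 1 := mul_right_cancel₀ hz0 ((hspec z hz).trans (one_mul z).symm)
  have hz1 : ‖z‖ = 1 := by
    have := congrArg norm hzs
    rw [norm_mul, norm_star, norm_one] at this
    nlinarith [norm_nonneg z]
  have huniq : ∀ w ∈ spectrum ℂ a, w ≠ 0 → w = z := by
    intro w hw hw0
    by_contra hne
    set d := dist w z / 2 with hd
    have hdpos : 0 < d := half_pos (dist_pos.2 hne)
    -- Tents of radius `d` centred at `z` and `w`; as `d` is half the distance, their supporting
    -- open balls are disjoint.
    let f : ℂ → ℂ → ℂ := fun p x => ((max 0 (d - dist x p) : ℝ) : ℂ)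
    have hfc : ∀ p, Continuous (f p) := fun p => by fun_prop
    have hfp : ∀ p, f p p ≠ 0 := fun p => by
      simp only [f, dist_self, sub_zero, max_eq_right hdpos.le]
      exact_mod_cast hdpos.ne'
    have hff : ∀ x, f z x * x * (f w x * x) = 0 := by
      intro x
      have : f z x = 0 ∨ f w x = 0 := by
        rcases le_total d (dist x z) with h | h
        · left; simp only [f, max_eq_left (sub_nonpos.2 h)]; rfl
        · right
          have h2 : d ≤ dist x w := by
            have := dist_triangle_left w z x
            linarith
          simp only [f, max_eq_left (sub_nonpos.2 h2)]; rfl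
      rcases this with h | h <;> simp [h]
    rcases hcz (hfc z) (hfc w) hff with h | h
    · exact mul_ne_zero (hfp z) hz0 (hval ((hfc z).mul continuous_id) h z hz)
    · exact mul_ne_zero (hfp w) hw0 (hval ((hfc w).mul continuous_id) h w hw)
  refine ⟨⟨z, by simp [Submonoid.unitSphere, hz1]⟩, ?_⟩
  change a = z • (a * star a)
  rw [haa, ← cfc_smul z _ a]
  nth_rw 1 [← cfc_id' ℂ a]
  refine cfc_congr fun x hx => ?_
  by_cases hx0 : x = 0
  · simp [hx0]
  · rw [huniq x hx hx0]
    simp only [smul_eq_mul, hzs, mul_one]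

/-! ### Identification with the Fock representation. -/

theorem Fock.family_e_of_push (z : Circle) {i : ℕ} {γ δ : Tup} (h : Tup.push i γ = some δ) :
    Fock.family z i (Fock.e γ) = Fock.e δ := by
  have hi := (Tup.push_isSome.1 (Option.isSome_of_mem h)).1
  obtain ⟨i, rfl⟩ := Nat.exists_eq_add_of_le' hi
  change Fock.shiftOp _ _ = _
  rw [Fock.shiftOp_e]
  change (Tup.push (i + 1) γ).elim 0 Fock.e = _
  rw [h]; rfl

theorem Fock.family_zero_apply (z : Circle) (f : Fock) :
    Fock.family z 0 f = ((z : ℂ) * f Tup.nil) • Fock.vacuum := by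
  change (z : ℂ) • Fock.vacuumProj f = _
  rw [Fock.vacuumProj, Submodule.starProjection_unit_singleton ℂ Fock.norm_vacuum f, Fock.vacuum,
    Fock.inner_e, smul_smul]

theorem word_family (z : Circle) (γ : Tup) : word (Fock.family z) γ Fock.vacuum = Fock.e γ := by
  induction γ using Tup.induction with
  | hnil => rfl
  | hpush i γ δ h ih => rw [word_of_push h, ih, Fock.family_e_of_push z h]

theorem Fock.vacuum_nil : Fock.vacuum Tup.nil = 1 := by
  classical
  rw [Fock.vacuum, Fock.e_apply, if_pos rfl]

theorem Fock.exists_family_zero (z : Circle) : ∃ y, Fock.family z 0 y = Fock.vacuum := by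
  refine ⟨(star (z : ℂ)) • Fock.vacuum, ?_⟩
  rw [Fock.family_zero_apply]
  change ((z : ℂ) * (star (z : ℂ) * Fock.vacuum Tup.nil)) • _ = _
  rw [Fock.vacuum_nil, mul_one, Complex.star_def, Complex.mul_conj, Circle.normSq_coe]
  simp

/-- An irreducible representation with `π(s_0) ≠ 0` is equivalent to some `π̃_{0,z}`. -/
theorem IsIrreducible.unitarilyEquivalent_piZero (hπ : IsIrreducible π) (h0 : π (OA.s 0) ≠ 0) :
    ∃ z : Circle, UnitarilyEquivalent π (piZero z) := by
  obtain ⟨z, hz⟩ := hπ.exists_eq_smul h0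
  refine ⟨z, ?_⟩
  have hS := isWMFamily_image π
  have hn : IsStarNormal (π (OA.s 0)) := hS.isStarNormal_zero
  have hpart := hS.self_star_self_apply 0
  obtain ⟨y, hy⟩ : ∃ y, π (OA.s 0) y ≠ 0 := by
    by_contra! h
    exact h0 (by ext x; exact h x)
  obtain ⟨x, hx, hx1⟩ : ∃ x, (∃ y, π (OA.s 0) y = x) ∧ ‖x‖ = 1 :=
    ⟨_, ⟨((‖π (OA.s 0) y‖⁻¹ : ℝ) : ℂ) • y, rfl⟩, by
      rw [map_smul, norm_smul, Complex.norm_real, norm_inv, norm_norm,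
        inv_mul_cancel₀ (norm_ne_zero_iff.2 hy)]⟩
  have hx2 : π (OA.s 0) (star (π (OA.s 0)) x) = x := by
    obtain ⟨y, rfl⟩ := hx; exact hpart y
  have hx3 : π (OA.s 0) x = (z : ℂ) • x := by
    have := DFunLike.congr_fun hz x
    change _ = (z : ℂ) • π (OA.s 0) (star (π (OA.s 0)) x) at this
    rwa [hx2] at this
  -- By normality `s_0* s_0` fixes `x`, which with `s_0 x = z x` determines the adjoint. So the line
  -- through `x` reduces `π(s_0)`.
  have hx4 : star (π (OA.s 0)) x = star (z : ℂ) • x := by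
    have h5 : star (π (OA.s 0)) (π (OA.s 0) x) = x :=
      (DFunLike.congr_fun hn.star_comm_self x).trans hx2
    have hz1 : star (z : ℂ) * (z : ℂ) = 1 := by
      rw [mul_comm, Complex.star_def, Complex.mul_conj, Circle.normSq_coe]; norm_num
    rw [hx3, map_smul] at h5
    nth_rw 2 [← h5]
    rw [smul_smul, hz1, one_smul]
  have hxne : x ≠ 0 := norm_ne_zero_iff.1 (by rw [hx1]; exact one_ne_zero)
  have htop := hπ.wordSpan_eq_top (K := Submodule.span ℂ {x})
    (by rwa [Ne, Submodule.span_singleton_eq_bot])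
    (by
      intro v hv
      obtain ⟨c, rfl⟩ := Submodule.mem_span_singleton.1 hv
      obtain ⟨y, hy⟩ := hx
      exact ⟨c • y, by rw [map_smul, hy]⟩)
    (by
      intro v hv
      obtain ⟨c, rfl⟩ := Submodule.mem_span_singleton.1 hv
      rw [map_smul, hx3]
      exact Submodule.smul_mem _ _ (Submodule.smul_mem _ _ (Submodule.mem_span_singleton_self x)))
    (by
      intro v hv
      obtain ⟨c, rfl⟩ := Submodule.mem_span_singleton.1 hv
      rw [map_smul, hx4]
      exact Submodule.smul_mem _ _ (Submodule.smul_mem _ _ (Submodule.mem_span_singleton_self x)))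
  have hdense : ⊤ ≤ (Submodule.span ℂ
      (Set.range fun γ => word (fun i => π (OA.s i)) γ x)).topologicalClosure := by
    rw [← htop, wordSpan]
    refine Submodule.topologicalClosure_mono (Submodule.span_le.2 ?_)
    rintro _ ⟨γ, v, hv, rfl⟩
    obtain ⟨c, rfl⟩ := Submodule.mem_span_singleton.1 hv
    rw [word_smul]
    exact Submodule.smul_mem _ _ (Submodule.subset_span ⟨γ, rfl⟩)
  let b : HilbertBasis Tup ℂ H := HilbertBasis.mk (hS.orthonormal_word hx hx1) hdense
  have hb : ∀ γ, b γ = word (fun i => π (OA.s i)) γ x := fun γ => by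
    rw [HilbertBasis.coe_mk]
  have hbe : ∀ γ, b.repr (word (fun i => π (OA.s i)) γ x) = Fock.e γ := fun γ => by
    classical
    rw [← hb, b.repr_self, Fock.e]
  have hx0 : b.repr x = Fock.vacuum := hbe Tup.nil
  -- Both sides are continuous and linear, so words suffice; when the first letter exceeds `i`, both
  -- sides vanish.
  have hgen : ∀ i v, b.repr (π (OA.s i) v) = Fock.family z i (b.repr v) := by
    intro i
    have h : ((b.repr : H ≃L[ℂ] Fock) : H →L[ℂ] Fock).comp (π (OA.s i)) =
        (Fock.family z i).comp ((b.repr : H ≃L[ℂ] Fock) : H →L[ℂ] Fock) := by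
      refine ContinuousLinearMap.ext_on
        (s := Set.range fun γ => word (fun i => π (OA.s i)) γ x) ?_ ?_
      · exact Submodule.dense_iff_topologicalClosure_eq_top.2 (top_le_iff.1 hdense)
      · rintro _ ⟨γ, rfl⟩
        change b.repr (π (OA.s i) _) = Fock.family z i (b.repr _)
        rw [hbe]
        by_cases h : γ.head ≤ i
        · rcases Nat.eq_zero_or_pos i with rfl | hi
          · obtain rfl := Tup.head_eq_zero.1 (Nat.le_zero.1 h)
            change b.repr (π (OA.s 0) x) = Fock.family z 0 Fock.vacuum
            rw [hx3, map_smul, hx0, Fock.family_zero_apply, Fock.vacuum_nil, mul_one]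
          · obtain ⟨δ, hδ⟩ := Option.isSome_iff_exists.1 (Tup.push_isSome.2 ⟨hi, h⟩)
            rw [Fock.family_e_of_push z hδ, ← hbe, word_of_push hδ]
        · rw [hS.word_of_lt hx (not_le.1 h), map_zero, ← word_family z,
            (Fock.isWMFamily_family z).word_of_lt (Fock.exists_family_zero z) (not_le.1 h)]
    exact fun v => DFunLike.congr_fun h v
  refine ⟨b.repr, fun a v => ?_⟩
  -- Conjugation by the unitary is a `*`-homomorphism, so intertwining on generators extends to the
  -- whole algebra.
  let c : (H →L[ℂ] H) ≃⋆ₐ[ℂ] (Fock →L[ℂ] Fock) := b.repr.conjStarAlgEquiv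
  have h : (c : (H →L[ℂ] H) →⋆ₙₐ[ℂ] (Fock →L[ℂ] Fock)).comp π = piZero z := by
    refine OA.hom_ext fun i => ?_
    rw [piZero, OA.lift_s]
    ext1 f
    change b.repr (π (OA.s i) (b.repr.symm f)) = _
    rw [hgen, b.repr.apply_symm_apply]
  rw [← h]
  change _ = b.repr (π a (b.repr.symm (b.repr v)))
  rw [b.repr.symm_apply_apply]

/-! ### Irreducibility of the Fock representations and the general classification. -/

theorem piZero_s (z : Circle) (i : ℕ) : piZero z (OA.s i) = Fock.family z i := OA.lift_s _ i

theorem piZero_s_zero_ne (z : Circle) : piZero z (OA.s 0) ≠ 0 := by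
  intro h
  obtain ⟨y, hy⟩ := Fock.exists_family_zero z
  rw [← piZero_s, h] at hy
  have := Fock.norm_vacuum
  rw [← hy] at this
  simp at this

theorem isIrreducible_piZero (z : Circle) : IsIrreducible (piZero z) := by
  refine ⟨fun h => piZero_s_zero_ne z (by rw [h]; rfl), fun M hM hinv => ?_⟩
  rw [or_iff_not_imp_left]
  intro hne
  obtain ⟨f, hf, hf0⟩ := Submodule.exists_mem_ne_zero_of_ne_bot hne
  have h1 : ∀ i, ∀ f ∈ M, Fock.family z i f ∈ M := fun i f hf => by
    rw [← piZero_s]; exact hinv _ f hf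
  have h2 : ∀ i, ∀ f ∈ M, star (Fock.family z i) f ∈ M := fun i f hf => by
    rw [← piZero_s, ← map_star]; exact hinv _ f hf
  have hvac : Fock.vacuum ∈ M := by
    have key : ∀ γ, ∀ f ∈ M, f γ ≠ 0 → Fock.vacuum ∈ M := by
      intro γ
      induction γ using Tup.induction with
      | hnil =>
        intro f hf h
        have := h1 0 f hf
        rw [Fock.family_zero_apply] at this
        exact (M.smul_mem_iff (mul_ne_zero (Circle.coe_ne_zero z) h)).1 this
      | hpush i γ δ h ih =>
        intro f hf hδ
        -- The coefficient of `A_i f` at `γ` is that of `f` at `δ = (i, γ)`. Stripping letters ends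
        -- with a nonzero vacuum coefficient, which `z P_Ω` isolates.
        refine ih _ (h2 i f hf) ?_
        rwa [← Fock.inner_e, ContinuousLinearMap.star_eq_adjoint,
          ContinuousLinearMap.adjoint_inner_right, Fock.family_e_of_push z h, Fock.inner_e]
    obtain ⟨γ, hγ⟩ : ∃ γ, f γ ≠ 0 := by
      by_contra! h
      exact hf0 (lp.ext (funext h))
    exact key γ f hf hγ
  have he : ∀ γ, Fock.e γ ∈ M := by
    intro γ
    induction γ using Tup.induction with
    | hnil => exact hvac
    | hpush i γ δ h ih => rw [← Fock.family_e_of_push z h]; exact h1 i _ ih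
  have : CompleteSpace M := hM.completeSpace_coe
  -- A vector orthogonal to `M` has all its coordinates, the inner products with `e_γ`, equal to
  -- zero.
  rw [← Submodule.orthogonal_eq_bot_iff, eq_bot_iff]
  intro g hg
  refine lp.ext (funext fun γ => ?_)
  rw [← Fock.inner_e]
  exact (Submodule.mem_orthogonal _ _).1 hg _ (he γ)

theorem IsIrreducible.comp_surjective {A B : Type*} [NonUnitalCStarAlgebra A]
    [NonUnitalCStarAlgebra B] {π : B →⋆ₙₐ[ℂ] (H →L[ℂ] H)} (hπ : IsIrreducible π)
    {θ : A →⋆ₙₐ[ℂ] B} (hθ : Function.Surjective θ) : IsIrreducible (π.comp θ) := by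
  refine ⟨fun h => hπ.1 ?_, fun M hM h => hπ.2 M hM fun b => ?_⟩
  · ext1 b
    obtain ⟨a, rfl⟩ := hθ b
    exact DFunLike.congr_fun h a
  · obtain ⟨a, rfl⟩ := hθ b
    exact h a

theorem IsIrreducible.of_comp {A B : Type*} [NonUnitalCStarAlgebra A]
    [NonUnitalCStarAlgebra B] {π : B →⋆ₙₐ[ℂ] (H →L[ℂ] H)} {θ : A →⋆ₙₐ[ℂ] B}
    (hπ : IsIrreducible (π.comp θ)) : IsIrreducible π := by
  refine ⟨fun h => hπ.1 ?_, fun M hM h => hπ.2 M hM fun a => h (θ a)⟩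
  rw [h]; rfl

theorem isIrreducible_piTilde {n : ℕ} (Ψ : OA ≃⋆ₐ[ℂ] Q n) (z : Circle) :
    IsIrreducible (piTilde Ψ z) :=
  (isIrreducible_piZero z).comp_surjective (Ψ.symm.surjective.comp (proj_surjective n))

theorem IsIrreducible.unitarilyEquivalent_piTilde (hπ : IsIrreducible π)
    {Ψ : (n : ℕ) → OA ≃⋆ₐ[ℂ] Q n} (hΨ : ∀ n i, Ψ n (OA.s i) = proj n (OA.s (i + n))) :
    ∃ (n : ℕ) (z : Circle), UnitarilyEquivalent π (piTilde (Ψ n) z) := by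
  classical
  have hex : ∃ n, π (OA.s n) ≠ 0 := by
    by_contra! h
    exact hπ.1 (OA.hom_ext fun i => h i)
  let n := Nat.find hex
  have hlt : ∀ i < n, π (OA.s i) = 0 := fun i hi => not_not.1 (Nat.find_min hex hi)
  -- With `n` least such that `π(s_n) ≠ 0`, the tail gives `π'` with `π'(s_0) = π(s_n) ≠ 0` and `π =
  -- π' ∘ unshift n`.
  let π' : OA →⋆ₙₐ[ℂ] (H →L[ℂ] H) := OA.lift ((isWMFamily_image π).tail hlt)
  have hπ's : ∀ i, π' (OA.s i) = π (OA.s (i + n)) := OA.lift_s _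
  have hcomp : π'.comp (unshift n) = π := by
    refine OA.hom_ext fun i => ?_
    change π' (unshift n (OA.s i)) = _
    rw [unshift_s]
    split_ifs with h
    · rw [map_zero, hlt i h]
    · rw [hπ's, Nat.sub_add_cancel (not_lt.1 h)]
  have hirr : IsIrreducible π' := IsIrreducible.of_comp (θ := unshift n) (by rwa [hcomp])
  obtain ⟨z, U, hU⟩ := hirr.unitarilyEquivalent_piZero (by
    rw [hπ's, Nat.zero_add]; exact Nat.find_spec hex)
  refine ⟨n, z, U, fun a x => ?_⟩
  rw [← hcomp]
  change U (π' (unshift n a) x) = piZero z ((Ψ n).symm (proj n a)) (U x)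
  rw [symm_proj_eq_unshift (hΨ n), hU]

theorem UnitarilyEquivalent.s_zero_ne {z : Circle} (h : UnitarilyEquivalent π (piZero z)) :
    π (OA.s 0) ≠ 0 := by
  obtain ⟨U, hU⟩ := h
  intro h0
  refine piZero_s_zero_ne z ?_
  ext1 f
  have := hU (OA.s 0) (U.symm f)
  rw [h0, U.apply_symm_apply] at this
  rw [← this]
  exact map_zero U

end Irreducible

end WM

end

/-- Quantifying over all families `Ψ` with the defining property loses nothing, since the first
clause says that exactly one exists. -/
theorem mainTheorem9 :
    (∀ n : ℕ, ∃! Ψ : WM.OA ≃⋆ₐ[ℂ] WM.Q n, ∀ i, Ψ (WM.OA.s i) = WM.proj n (WM.OA.s (i + n))) ∧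
    ∀ Ψ : (n : ℕ) → WM.OA ≃⋆ₐ[ℂ] WM.Q n,
      (∀ n i, Ψ n (WM.OA.s i) = WM.proj n (WM.OA.s (i + n))) →
      (∀ (n : ℕ) (z : Circle), WM.IsIrreducible (WM.piTilde (Ψ n) z)) ∧
      (∀ z : Circle, WM.IsIrreducible (WM.piZero z) ∧ WM.piZero z (WM.OA.s 0) ≠ 0) ∧
      ∀ (H : Type*) [NormedAddCommGroup H] [InnerProductSpace ℂ H] [CompleteSpace H]
        (π : WM.OA →⋆ₙₐ[ℂ] (H →L[ℂ] H)), WM.IsIrreducible π →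
        (∃ (n : ℕ) (z : Circle), WM.UnitarilyEquivalent π (WM.piTilde (Ψ n) z)) ∧
        (π (WM.OA.s 0) ≠ 0 ↔ ∃ z : Circle, WM.UnitarilyEquivalent π (WM.piZero z)) :=
  ⟨WM.existsUnique_shiftEquiv, fun Ψ hΨ =>
    ⟨fun n z => WM.isIrreducible_piTilde (Ψ n) z,
      fun z => ⟨WM.isIrreducible_piZero z, WM.piZero_s_zero_ne z⟩,
      fun _ _ _ _ _ hπ => ⟨hπ.unitarilyEquivalent_piTilde hΨ,
        hπ.unitarilyEquivalent_piZero, fun ⟨_, h⟩ => h.s_zero_ne⟩⟩⟩
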